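/- For integers $k \ge 2$ and $p_1,\dots,p_k \ge 1$, let $K_{p_1,\dots,p_k}$ be the $(p_1,\dots,p_k,-1,\dots,-1)$ pretzel link with $k-2$ entries $-1$. It has $2k-2$ twist columns, an even number, and it is oriented so that the two strands of each column run parallel, upwards and downwards alternately from one column to the next. Its (one-variable) Alexander polynomial is well defined up to factors $\pm t^n$, so that its Mahler measure $M(K_{p_1,\dots,p_k})$ is well defined. Then $M(K_{2,3,7}) > 1$ and, for all $k \ge 2$ and all $p_1,\dots,p_k \ge 1$ with $M(K_{p_1,\dots,p_k}) \ne 1$, $$M(K_{2,3,7}) \le M(K_{p_1,\dots,p_k}).$$ That is, among the links $K_{p_1,\dots,p_k}$ whose Alexander polynomial does not have the trivial Mahler measure $1$, the Mahler measure of the Alexander polynomial is smallest for $K_{2,3,7}$. -/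

import Mathlib

open Polynomial LaurentPolynomial

/-- An oriented link diagram all of whose components meet some crossing, recorded by its signed
Gauss code. Every crossing `c` is traversed twice: the two passages are `(c, true)` and
`(c, false)`, and `(c, overpass c)` is the one that runs over the other. Following the orientation of
the link from a passage one arrives at the passage `next`; the edge of the diagram between the two
is named after the passage that it leaves. `sign c` is the usual sign of the crossing. -/
structure LinkDiagram where
  Crossing : Type
  [fintype : Fintype Crossing]
  [decEq : DecidableEq Crossing]
  next : Equiv.Perm (Crossing × Bool)
  overpass : Crossing → Bool
  sign : Crossing → ℤˣ

namespace LinkDiagram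

attribute [instance] LinkDiagram.fintype LinkDiagram.decEq

/-- The Alexander matrix of a diagram: the Fox Jacobian of the Wirtinger presentation of the link
group, every meridian being sent to `T`. The generators (columns) are the edges of the diagram. The
row of an overpass says that the edge leaving it equals the edge entering it. The row of an
underpass at a crossing of sign `s` with overpassing edge `o` is the relation
`out = T ^ s * in + (1 - T ^ s) * o`. -/
noncomputable def alexanderMatrix (D : LinkDiagram) :
    Matrix (D.Crossing × Bool) (D.Crossing × Bool) ℤ[T;T⁻¹] :=
  Matrix.of fun x =>
    if x.2 = D.overpass x.1 then
      Pi.single x 1 - Pi.single (D.next.symm x) 1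
    else
      Pi.single x 1 - Pi.single (D.next.symm x) (T (D.sign x.1 : ℤ))
        - Pi.single (x.1, D.overpass x.1) (1 - T (D.sign x.1 : ℤ))

/-- `P` is an Alexander polynomial of `D`: in `ℤ[T;T⁻¹]` it is a greatest common divisor of the
minors of the Alexander matrix of size one less than the number of generators (up to sign, these
are the entries of the adjugate matrix). This determines `P` up to a factor `± X ^ n`. -/
def IsAlexanderPolynomial (D : LinkDiagram) (P : ℤ[X]) : Prop :=
  ∀ Q : ℤ[T;T⁻¹], Q ∣ toLaurent P ↔ ∀ i j, Q ∣ D.alexanderMatrix.adjugate i j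

theorem exists_isAlexanderPolynomial (D : LinkDiagram) : ∃ P, D.IsAlexanderPolynomial P := by
  classical
  have : UniqueFactorizationMonoid ℤ[T;T⁻¹] :=
    UniqueFactorizationMonoid.of_isLocalization (Submonoid.powers (X : ℤ[X])) ℤ[T;T⁻¹]
  let _ : StrongNormalizationMonoid ℤ[T;T⁻¹] :=
    UniqueFactorizationMonoid.strongNormalizationMonoid
  let _ : NormalizedGCDMonoid ℤ[T;T⁻¹] := UniqueFactorizationMonoid.toNormalizedGCDMonoid _
  obtain ⟨n, P, hP⟩ := LaurentPolynomial.exists_T_pow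
    ((Finset.univ : Finset ((D.Crossing × Bool) × (D.Crossing × Bool))).gcd
      fun ij => D.alexanderMatrix.adjugate ij.1 ij.2)
  refine ⟨P, fun Q => ?_⟩
  rw [hP, (LaurentPolynomial.isUnit_T (R := ℤ) n).dvd_mul_right, Finset.dvd_gcd_iff]
  simp [Prod.forall]

/-- The Alexander polynomial of the link with diagram `D` (a choice among its representatives, which
differ by factors `± X ^ n`). -/
noncomputable def alexanderPolynomial (D : LinkDiagram) : ℤ[X] :=
  D.exists_isAlexanderPolynomial.choose

end LinkDiagram

section Pretzel

variable {m : ℕ} (q : Fin m → ℤ) (hq : ∀ i, q i ≠ 0)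

/-- The crossings of a pretzel diagram with columns of `|q 0|, …, |q (m - 1)|` half twists: `⟨i, j⟩`
is the crossing at height `j` (counted from the bottom) in the column `i`. -/
abbrev PretzelCrossing : Type := Σ i : Fin m, Fin (q i).natAbs

/-- One step along a pretzel diagram. At each crossing one strand is rising (from south-west to
north-east, flag `true`) and one is falling (from north-west to south-east, flag `false`). Inside a
column, the north-west and north-east corners of a crossing are joined to the south-west and
south-east corners of the crossing above it. The north-east corner at the top of a column is joined
to the north-west corner at the top of the column to its right, the south-east corner at the bottom
of a column to the south-west corner at the bottom of the column to its right, columns being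
arranged cyclically. Both strands of column `i` are traversed upwards if `up i` and downwards
otherwise. -/
def pretzelStep (up : Fin m → Bool) : PretzelCrossing q × Bool → PretzelCrossing q × Bool
  | (⟨i, j⟩, rising) =>
    if up i then
      if h : j.val + 1 < (q i).natAbs then (⟨i, ⟨j.val + 1, h⟩⟩, !rising)
      else
        let i' := if rising then finRotate m i else (finRotate m).symm i
        (⟨i', ⟨(q i').natAbs - 1, Nat.sub_lt (Int.natAbs_pos.2 (hq i')) one_pos⟩⟩, !rising)
    else
      if 0 < j.val then (⟨i, ⟨j.val - 1, lt_of_le_of_lt (Nat.sub_le _ _) j.isLt⟩⟩, !rising)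
      else
        let i' := if rising then (finRotate m).symm i else finRotate m i
        (⟨i', ⟨0, Int.natAbs_pos.2 (hq i')⟩⟩, !rising)

theorem pretzelStep_up_lt {up : Fin m → Bool} {i : Fin m} (hu : up i = true)
    (j : Fin (q i).natAbs) (h : j.val + 1 < (q i).natAbs) (r : Bool) :
    pretzelStep q hq up (⟨i, j⟩, r) = (⟨i, ⟨j.val + 1, h⟩⟩, !r) := by
  simp only [pretzelStep]
  rw [if_pos hu, dif_pos h]

theorem pretzelStep_up_top {up : Fin m → Bool} {i : Fin m} (hu : up i = true)
    (j : Fin (q i).natAbs) (h : ¬ j.val + 1 < (q i).natAbs) (r : Bool) (i' : Fin m)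
    (hi' : i' = if r then finRotate m i else (finRotate m).symm i) :
    pretzelStep q hq up (⟨i, j⟩, r) =
      (⟨i', ⟨(q i').natAbs - 1, Nat.sub_lt (Int.natAbs_pos.2 (hq i')) one_pos⟩⟩, !r) := by
  subst hi'
  simp only [pretzelStep]
  rw [if_pos hu, dif_neg h]

theorem pretzelStep_down_pos {up : Fin m → Bool} {i : Fin m} (hu : ¬ up i = true)
    (j : Fin (q i).natAbs) (h : 0 < j.val) (r : Bool) :
    pretzelStep q hq up (⟨i, j⟩, r) =
      (⟨i, ⟨j.val - 1, lt_of_le_of_lt (Nat.sub_le _ _) j.isLt⟩⟩, !r) := by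
  simp only [pretzelStep]
  rw [if_neg hu, if_pos h]

theorem pretzelStep_down_bottom {up : Fin m → Bool} {i : Fin m} (hu : ¬ up i = true)
    (j : Fin (q i).natAbs) (h : ¬ 0 < j.val) (r : Bool) (i' : Fin m)
    (hi' : i' = if r then (finRotate m).symm i else finRotate m i) :
    pretzelStep q hq up (⟨i, j⟩, r) = (⟨i', ⟨0, Int.natAbs_pos.2 (hq i')⟩⟩, !r) := by
  subst hi'
  simp only [pretzelStep]
  rw [if_neg hu, if_neg h]

theorem pretzelStep_pretzelStep (up : Fin m → Bool) (hup : ∀ i, up (finRotate m i) = !up i)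
    (x : PretzelCrossing q × Bool) :
    pretzelStep q hq (fun i => !up i) (pretzelStep q hq up x) = x := by
  have hup' : ∀ i, up ((finRotate m).symm i) = !up i := fun i => by
    have := hup ((finRotate m).symm i)
    rw [Equiv.apply_symm_apply] at this
    simp [this]
  obtain ⟨⟨i, j⟩, r⟩ := x
  have hj := j.isLt
  by_cases hu : up i = true
  · by_cases h : j.val + 1 < (q i).natAbs
    · rw [pretzelStep_up_lt q hq hu j h,
        pretzelStep_down_pos q hq (by simp [hu]) _ (Nat.succ_pos _)]
      simp
    · set i' := if r then finRotate m i else (finRotate m).symm i with hi'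
      have hu' : up i' = false := by
        rw [hi']; split_ifs <;> simp only [hup, hup', hu, Bool.not_true]
      have h1 := Int.natAbs_pos.2 (hq i')
      rw [pretzelStep_up_top q hq hu j h r i' hi',
        pretzelStep_up_top q hq (by simp [hu']) _ (by dsimp only; omega) (!r) i
          (by
            rw [hi']
            cases r
            exacts [((finRotate m).apply_symm_apply i).symm,
              ((finRotate m).symm_apply_apply i).symm])]
      have : (⟨(q i).natAbs - 1, Nat.sub_lt (Int.natAbs_pos.2 (hq i)) one_pos⟩ :
          Fin (q i).natAbs) = j := Fin.ext (by dsimp only; omega)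
      rw [this, Bool.not_not]
  · by_cases h : 0 < j.val
    · rw [pretzelStep_down_pos q hq hu j h,
        pretzelStep_up_lt q hq (by simp [hu]) _ (by dsimp only; omega)]
      have : (⟨j.val - 1 + 1, by omega⟩ : Fin (q i).natAbs) = j :=
        Fin.ext (by dsimp only; omega)
      simp [this]
    · set i' := if r then (finRotate m).symm i else finRotate m i with hi'
      have hu' : up i' = true := by
        rw [Bool.not_eq_true] at hu
        rw [hi']; split_ifs <;> simp only [hup, hup', hu, Bool.not_false]
      rw [pretzelStep_down_bottom q hq hu j h r i' hi',
        pretzelStep_down_bottom q hq (by simp [hu']) _ (by simp) (!r) i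
          (by
            rw [hi']
            cases r
            exacts [((finRotate m).symm_apply_apply i).symm,
              ((finRotate m).apply_symm_apply i).symm])]
      have : (⟨0, Int.natAbs_pos.2 (hq i)⟩ : Fin (q i).natAbs) = j :=
        Fin.ext (by dsimp only; omega)
      rw [this, Bool.not_not]

theorem even_finRotate (hm : Even m) (i : Fin m) :
    decide (Even (finRotate m i).val) = !decide (Even i.val) := by
  obtain _ | n := m
  · exact i.elim0
  · rw [coe_finRotate]
    split_ifs with h
    · subst h
      have : ¬ Even n := by simpa [Nat.even_add_one] using hm
      simp [this]
    · simp [Nat.even_add_one, -Nat.not_even_iff_odd]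

/-- The standard diagram of the pretzel link `(q 0, …, q (m - 1))` with an even number `m` of
columns, oriented so that the two strands of each column run parallel, upwards in the columns of
even index and downwards in the others. The crossings of column `i` all have the sign of `q i`
(when the two strands are parallel, a crossing is positive exactly if its rising strand is on
top). -/
def pretzelDiagram (hm : Even m) : LinkDiagram where
  Crossing := PretzelCrossing q
  next :=
    { toFun := pretzelStep q hq fun i => decide (Even i.val)
      invFun := pretzelStep q hq fun i => !decide (Even i.val)
      left_inv := pretzelStep_pretzelStep q hq _ (even_finRotate hm)
      right_inv := fun x => by
        simpa using pretzelStep_pretzelStep q hq (fun i => !decide (Even i.val))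
          (fun i => by rw [even_finRotate hm]) x }
  overpass := fun c => decide (0 < q c.1)
  sign := fun c => if 0 < q c.1 then 1 else -1

end Pretzel

/-- The pretzel link `K_{p 0, …, p (k - 1)}`: the `(p 0, …, p (k - 1), -1, …, -1)` pretzel link with
`k - 2` entries `-1`. -/
def pretzelLink {k : ℕ} (hk : 2 ≤ k) (p : Fin k → ℕ) (hp : ∀ i, 0 < p i) : LinkDiagram :=
  pretzelDiagram (Fin.append (fun i => (p i : ℤ)) fun _ : Fin (k - 2) => -1)
    (fun i => Fin.addCases (fun i => by simpa using (hp i).ne') (fun i => by simp) i)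
    (by rw [Nat.even_iff]; omega)

/-- The Mahler measure of the Alexander polynomial of the link with diagram `D`. -/
noncomputable def LinkDiagram.alexanderMahlerMeasure (D : LinkDiagram) : ℝ :=
  (D.alexanderPolynomial.map (Int.castRingHom ℂ)).mahlerMeasure

/-! Up to a unit and the substitution `X ↦ -X`, which preserves Mahler measure, the Alexander
polynomial of the link is the Coxeter polynomial of a star-shaped tree, `starPolynomial`. This
reduces the theorem to a comparison of star polynomials.

For the Alexander polynomial, the Wirtinger relations have one relation with unit coefficients among
their rows and one among their columns, so a single cofactor suffices (`Matrix.dvd_adjugate_iff`).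
Solving the relations inside each column in closed form leaves a system in the values at the column
exits (`dvd_adjugate_alexanderMatrix_pretzel`). Its determinant is found by elimination around the
ring of columns (`det_exitRelations`).

For the comparison, at a real `x ≥ 0` the star polynomial is a positive number times `x + 1 - ∑ (1 -
1/[p])`, the sum running over the arms `p`. Let `μ ≈ 1.176` be Lehmer's number, the Mahler measure
and a zero for `(2, 3, 7)`. If the sum is at least `μ + 1` at `μ`, the polynomial has a real zero `≥
μ`, so its Mahler measure is at least `μ`. The sum is monotone in the arms, and every hyperbolic
type dominates one of `(2,3,7)`, `(2,4,5)`, `(3,3,4)`, `(2,2,2,3)`, `(2,2,2,2,2)`, where the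
inequality holds. The other types are spherical or affine, and their polynomials divide products of
factors `X ^ a - 1`, hence have measure `1` (`star_sorted_dichotomy`). -/

namespace Matrix

/-! ### Cofactors of matrices with a row relation and a column relation -/

section Adjugate

variable {ι R : Type*} [Fintype ι] [DecidableEq ι] [CommRing R] [IsDomain R]

/-- The difference of the two cofactors is the determinant of `A` with row `j` replaced by `e_i -
e_i'`, and this matrix still kills the all-ones vector. -/
theorem adjugate_apply_eq_of_mulVec_one {A : Matrix ι ι R} (h : A *ᵥ 1 = 0) (i i' j : ι) :
    A.adjugate i j = A.adjugate i' j := by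
  rw [← sub_eq_zero, adjugate_apply, adjugate_apply]
  have h1 : (A.updateRow j (Pi.single i 1)).det - (A.updateRow j (Pi.single i' 1)).det =
      (A.updateRow j (Pi.single i 1 - Pi.single i' 1)).det := by
    have := det_updateRow_add A j (Pi.single i 1 - Pi.single i' 1) (Pi.single i' 1)
    rw [sub_add_cancel] at this
    rw [this, add_sub_cancel_right]
  rw [h1]
  refine exists_mulVec_eq_zero_iff.1 ⟨1, fun h0 => one_ne_zero (congrFun h0 i), ?_⟩
  funext x
  by_cases hx : x = j
  · subst hx
    simp only [mulVec, updateRow_self]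
    rw [sub_dotProduct]
    simp
  · have := congrFun h x
    simpa [mulVec, updateRow_ne hx] using this

theorem mul_adjugate_apply_eq_of_vecMul {A : Matrix ι ι R} {w : ι → R} (h : w ᵥ* A = 0)
    (hw : w ≠ 0) (i j j' : ι) : w j' * A.adjugate i j = w j * A.adjugate i j' := by
  have key : ∀ j, A.adjugate i j = (A.updateCol i (Pi.single j 1)).det := fun j => by
    rw [← cramer_apply, cramer_eq_adjugate_mulVec]
    simp
  rw [key, key, ← det_updateCol_smul, ← det_updateCol_smul, ← sub_eq_zero]
  have h1 : (A.updateCol i (w j' • Pi.single j 1)).det - (A.updateCol i (w j • Pi.single j' 1)).det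
      = (A.updateCol i (w j' • Pi.single j 1 - w j • Pi.single j' 1)).det := by
    have := det_updateCol_add A i (w j' • Pi.single j 1 - w j • Pi.single j' 1)
      (w j • Pi.single j' 1)
    rw [sub_add_cancel] at this
    rw [this, add_sub_cancel_right]
  rw [h1]
  refine exists_vecMul_eq_zero_iff.1 ⟨w, hw, ?_⟩
  funext x
  by_cases hx : x = i
  · subst hx
    simp only [vecMul, updateCol_self, Pi.zero_apply]
    rw [dotProduct_sub]
    simp [mul_comm]
  · have := congrFun h x
    simpa [vecMul, updateCol_ne hx] using this

/-- If the rows of a matrix sum to zero and its columns, weighted by units, sum to zero, then all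
entries of its adjugate are associated. -/
theorem dvd_adjugate_iff {A : Matrix ι ι R} (h : A *ᵥ 1 = 0) {w : ι → R} (hw : ∀ i, IsUnit (w i))
    (hA : w ᵥ* A = 0) (i₀ j₀ : ι) (Q : R) :
    (∀ i j, Q ∣ A.adjugate i j) ↔ Q ∣ A.adjugate i₀ j₀ := by
  refine ⟨fun h => h _ _, fun hQ i j => ?_⟩
  rw [adjugate_apply_eq_of_mulVec_one h i i₀]
  have hw0 : w ≠ 0 := fun h0 => not_isUnit_zero (congrFun h0 i ▸ hw i)
  rw [← (hw j₀).dvd_mul_left, mul_adjugate_apply_eq_of_vecMul hA hw0]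
  exact hQ.mul_left _

end Adjugate

variable {ι R : Type*} [Fintype ι] [DecidableEq ι] [CommRing R]

/-- This turns a cofactor into the determinant of a full-size perturbed matrix, so that the matrix
can be handled as a linear endomorphism without deleting a row and a column. -/
theorem det_add_single (A : Matrix ι ι R) (i j : ι) :
    (A + single j i 1).det = A.det + A.adjugate i j := by
  have : A + single j i 1 = A.updateRow j (A j + Pi.single i 1) := by
    ext x y
    by_cases hx : x = j
    · subst hx
      simp [single_apply, Pi.single_apply, eq_comm]
    · simp [updateRow_ne hx, Ne.symm hx]
  rw [this, det_updateRow_add, updateRow_eq_self, adjugate_apply]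

end Matrix

/-! ### Determinants of linear endomorphisms -/

namespace LinearMap

variable {ι κ R : Type*} [Fintype ι] [DecidableEq ι] [Fintype κ] [DecidableEq κ] [CommRing R]

/-- A triangularity criterion: up to the diagonal term, the coordinate `i` of `f y` depends only on
the coordinates of `y` of smaller rank. -/
theorem det_eq_prod_of_rank (f : (ι → R) →ₗ[R] ι → R) (rank : ι → ℕ) (d : ι → R)
    (h : ∀ y i, (∀ j, rank j < rank i → y j = 0) → f y i = d i * y i) :
    LinearMap.det f = ∏ i, d i := by
  rw [← LinearMap.det_toMatrix']
  have key : ∀ i j, rank i ≤ rank j → LinearMap.toMatrix' f i j = if i = j then d i else 0 := by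
    intro i j hij
    rw [LinearMap.toMatrix'_apply, h]
    · simp [Pi.single_apply]
    · intro l hl
      have : l ≠ j := fun e => by subst e; omega
      simp [this]
  rw [← Matrix.det_transpose]
  have hT : (LinearMap.toMatrix' f).transpose.BlockTriangular rank := by
    intro i j hij
    have : j ≠ i := fun e => by subst e; omega
    rw [Matrix.transpose_apply, key j i hij.le, if_neg this]
  rw [hT.det]
  have : ∀ a ∈ Finset.univ.image rank,
      ((LinearMap.toMatrix' f).transpose.toSquareBlock rank a).det =
        ∏ i with rank i = a, d i := by
    intro a _
    have : (LinearMap.toMatrix' f).transpose.toSquareBlock rank a =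
        Matrix.diagonal fun i : {i // rank i = a} => d i := by
      ext i j
      rw [Matrix.toSquareBlock_def, Matrix.of_apply, Matrix.transpose_apply,
        key _ _ (by rw [i.2, j.2]), Matrix.diagonal_apply]
      by_cases hij : i = j
      · simp [hij]
      · rw [if_neg (fun e => hij (Subtype.ext e.symm)), if_neg hij]
    rw [this, Matrix.det_diagonal]
    exact (Finset.prod_subtype _ (by simp) _).symm
  rw [Finset.prod_congr rfl this]
  exact Finset.prod_fiberwise_of_maps_to (fun i _ => Finset.mem_image_of_mem _ (Finset.mem_univ i)) d

theorem det_one_sub_comp_comm (f : (ι → R) →ₗ[R] κ → R) (g : (κ → R) →ₗ[R] ι → R) :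
    LinearMap.det (1 - g ∘ₗ f) = LinearMap.det (1 - f ∘ₗ g) := by
  rw [← LinearMap.det_toMatrix', ← LinearMap.det_toMatrix', map_sub, map_sub,
    LinearMap.toMatrix'_comp, LinearMap.toMatrix'_comp, LinearMap.toMatrix'_one,
    LinearMap.toMatrix'_one, Matrix.det_one_sub_mul_comm]

/-- Cramer's rule for maps differing in one coordinate. -/
theorem det_mul_eq_of_forall_ne (f h : (ι → R) →ₗ[R] ι → R) (j : ι)
    (hfh : ∀ y i, i ≠ j → f y i = h y i) (y : ι → R) (s : R) (hy : h y = Pi.single j s) :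
    LinearMap.det f * s = LinearMap.det h * f y j := by
  rw [← LinearMap.det_toMatrix', ← LinearMap.det_toMatrix']
  set F := LinearMap.toMatrix' f with hF
  set H := LinearMap.toMatrix' h with hH
  have h1 : F = H.updateRow j (F j) := by
    ext a b
    by_cases ha : a = j
    · subst ha; simp
    · rw [Matrix.updateRow_ne ha, hF, hH, LinearMap.toMatrix'_apply, LinearMap.toMatrix'_apply,
        hfh _ _ ha]
  -- Apply the adjugate of `H` to `H y = s e_j`. The cofactors along row `j` do not involve that
  -- row, so they are common to `F` and `H`.
  have h2 : ∀ i, s * H.adjugate i j = H.det * y i := by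
    intro i
    have e : H.mulVec y = Pi.single j s := by rw [← hy, hH, LinearMap.toMatrix'_mulVec]
    have := congrArg (fun v => H.adjugate.mulVec v i) e
    simp only [Matrix.mulVec_mulVec, Matrix.adjugate_mul] at this
    simpa [Matrix.smul_mulVec, mul_comm] using this.symm
  have h3 : F.det = ∑ i, F j i * H.adjugate i j := by
    rw [Matrix.det_eq_sum_mul_adjugate_row F j]
    refine Finset.sum_congr rfl fun i _ => ?_
    rw [Matrix.adjugate_apply F, Matrix.adjugate_apply H, h1, Matrix.updateRow_idem,
      Matrix.updateRow_self]
  have h4 : f y j = ∑ i, F j i * y i := by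
    rw [← LinearMap.toMatrix'_mulVec f y]; rfl
  rw [h3, h4, Finset.sum_mul, Finset.mul_sum]
  refine Finset.sum_congr rfl fun i _ => ?_
  rw [mul_assoc, mul_comm _ s, h2]; ring

end LinearMap

/-! ### Wirtinger relations of pretzel diagrams and values along a column -/

theorem LinkDiagram.alexanderMatrix_mulVec (D : LinkDiagram) (y : D.Crossing × Bool → ℤ[T;T⁻¹])
    (x : D.Crossing × Bool) :
    (D.alexanderMatrix.mulVec y) x =
      if x.2 = D.overpass x.1 then y x - y (D.next.symm x)
      else y x - T (D.sign x.1 : ℤ) * y (D.next.symm x)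
        - (1 - T (D.sign x.1 : ℤ)) * y (x.1, D.overpass x.1) := by
  unfold LinkDiagram.alexanderMatrix
  simp only [Matrix.mulVec, Matrix.of_apply]
  split_ifs <;> simp only [sub_dotProduct, single_dotProduct, one_mul]

/-- The quantum integer `[k]` or `[-k]`, according to the sign of `q`, evaluated at `-T`. -/
noncomputable def twist (q : ℤ) (k : ℕ) : ℤ[T;T⁻¹] :=
  if 0 < q then ∑ i ∈ Finset.range k, (-T 1) ^ i else -∑ i ∈ Finset.range k, (-T (-1)) ^ (i + 1)

theorem twist_zero (q : ℤ) : twist q 0 = 0 := by simp [twist]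

theorem T_one_mul_T_neg_one : (T 1 * T (-1) : ℤ[T;T⁻¹]) = 1 := by
  rw [← T_add]; simp

/-- Quantum integers at `-T` satisfy `[k + 1] = 1 - T [k]`; for negative columns the same recurrence
is run backwards, as `[-k] = 1 - T [-(k + 1)]`. -/
theorem twist_succ_of_pos {q : ℤ} (hq : 0 < q) (k : ℕ) :
    twist q (k + 1) = 1 - T 1 * twist q k := by
  simp only [twist, if_pos hq, Finset.sum_range_succ', pow_zero, pow_succ, ← Finset.sum_mul]
  ring

theorem T_mul_twist_succ_of_not_pos {q : ℤ} (hq : ¬ 0 < q) (k : ℕ) :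
    T 1 * twist q (k + 1) = 1 - twist q k := by
  simp only [twist, if_neg hq]
  rw [Finset.sum_range_succ']
  simp only [pow_succ (-T (-1) : ℤ[T;T⁻¹]) (_ + 1), ← Finset.sum_mul]
  linear_combination (1 + (∑ i ∈ Finset.range k, (-T (-1) : ℤ[T;T⁻¹]) ^ (i + 1))) *
    T_one_mul_T_neg_one

section Pretzel

variable {n : ℕ} (q : Fin (n + 1) → ℤ) (hq : ∀ i, q i ≠ 0)

/-- The Alexander matrix of a pretzel diagram. -/
noncomputable def pretzelMatrix (hm : Even (n + 1)) :
    Matrix (PretzelCrossing q × Bool) (PretzelCrossing q × Bool) ℤ[T;T⁻¹] :=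
  (pretzelDiagram q hq hm).alexanderMatrix

/-- The passage before a given passage of a pretzel diagram. -/
def pretzelPrev : PretzelCrossing q × Bool → PretzelCrossing q × Bool :=
  pretzelStep q hq fun i => !decide (Even i.val)

/-- The exponent of `T` in the relation of an underpass of the column `i`. -/
def columnSign (i : Fin (n + 1)) : ℤ := if 0 < q i then 1 else -1

theorem pretzelMatrix_mulVec_over (hm : Even (n + 1)) (y : PretzelCrossing q × Bool → ℤ[T;T⁻¹])
    (c : PretzelCrossing q) :
    ((pretzelMatrix q hq hm).mulVec y) (c, decide (0 < q c.1)) =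
      y (c, decide (0 < q c.1)) - y (pretzelPrev q hq (c, decide (0 < q c.1))) := by
  have := (pretzelDiagram q hq hm).alexanderMatrix_mulVec y (c, decide (0 < q c.1))
  exact this.trans (if_pos rfl)

theorem pretzelMatrix_mulVec_under (hm : Even (n + 1)) (y : PretzelCrossing q × Bool → ℤ[T;T⁻¹])
    (c : PretzelCrossing q) :
    ((pretzelMatrix q hq hm).mulVec y) (c, !decide (0 < q c.1)) =
      y (c, !decide (0 < q c.1)) -
        T (columnSign q c.1) * y (pretzelPrev q hq (c, !decide (0 < q c.1))) -
        (1 - T (columnSign q c.1)) * y (c, decide (0 < q c.1)) := by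
  have := (pretzelDiagram q hq hm).alexanderMatrix_mulVec y (c, !decide (0 < q c.1))
  refine (this.trans (if_neg (Bool.not_ne_self _))).trans ?_
  have hs : ((((pretzelDiagram q hq hm).sign c : ℤˣ)) : ℤ) = columnSign q c.1 := by
    simp only [pretzelDiagram, columnSign]
    split_ifs <;> rfl
  simp only [hs]
  rfl

theorem pretzelStep_snd (up : Fin (n + 1) → Bool) (x : PretzelCrossing q × Bool) :
    (pretzelStep q hq up x).2 = !x.2 := by
  obtain ⟨⟨i, j⟩, r⟩ := x
  simp only [pretzelStep]
  split_ifs <;> rfl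

theorem pretzelMatrix_mulVec_one (hm : Even (n + 1)) : (pretzelMatrix q hq hm).mulVec 1 = 0 := by
  funext ⟨c, r⟩
  obtain rfl | rfl : r = decide (0 < q c.1) ∨ r = !decide (0 < q c.1) := by
    cases r <;> cases decide (0 < q c.1) <;> simp
  · rw [pretzelMatrix_mulVec_over]; simp
  · rw [pretzelMatrix_mulVec_under]; simp

/-- The coefficients of a linear relation between the Wirtinger relations. -/
noncomputable def relationWeight (x : PretzelCrossing q × Bool) : ℤ[T;T⁻¹] :=
  if 0 < q x.1.1 then 1 else T 1

theorem isUnit_relationWeight (x : PretzelCrossing q × Bool) : IsUnit (relationWeight q x) := by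
  unfold relationWeight
  split_ifs
  exacts [isUnit_one, isUnit_T 1]

theorem relationWeight_vecMul (hm : Even (n + 1)) :
    Matrix.vecMul (relationWeight q) (pretzelMatrix q hq hm) = 0 := by
  refine dotProduct_eq_zero _ fun y => ?_
  rw [← Matrix.dotProduct_mulVec]
  -- With the chosen weights, the two relations of a crossing add up to an outgoing minus an
  -- incoming combination whose form no longer depends on the sign of the crossing.
  have hc : ∀ c : PretzelCrossing q,
      ∑ r : Bool, relationWeight q (c, r) * ((pretzelMatrix q hq hm).mulVec y) (c, r) =
      ∑ r : Bool, ((if r then T 1 else 1) * y (c, r) -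
        (if r then 1 else T 1) * y (pretzelPrev q hq (c, r))) := by
    intro c
    have h1 := pretzelMatrix_mulVec_over q hq hm y c
    have h2 := pretzelMatrix_mulVec_under q hq hm y c
    simp only [Fintype.sum_bool, relationWeight]
    by_cases h : 0 < q c.1
    · simp only [h, decide_true, Bool.not_true, columnSign, if_true] at h1 h2 ⊢
      rw [h1, h2]
      simp only [Bool.false_eq_true, if_false]
      ring
    · simp only [h, decide_false, Bool.not_false, columnSign, if_false] at h1 h2 ⊢
      rw [h1, h2]
      simp only [Bool.false_eq_true, if_false, if_true]
      linear_combination (y (c, false) - y (pretzelPrev q hq (c, true))) * T_one_mul_T_neg_one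
  rw [dotProduct, Fintype.sum_prod_type, Finset.sum_congr rfl fun c _ => hc c,
    ← Fintype.sum_prod_type (fun x : PretzelCrossing q × Bool => (if x.2 then T 1 else 1) * y x -
        (if x.2 then 1 else T 1) * y (pretzelPrev q hq x)), Finset.sum_sub_distrib, sub_eq_zero]
  -- A step along the link flips the flag, so the coefficient with which an edge leaves one crossing
  -- is the one with which it enters the next.
  refine Fintype.sum_equiv (pretzelDiagram q hq hm).next _ _ fun x => ?_
  have h1 : pretzelPrev q hq ((pretzelDiagram q hq hm).next x) = x :=
    (pretzelDiagram q hq hm).next.symm_apply_apply x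
  have h2 : ((pretzelDiagram q hq hm).next x).2 = !x.2 := pretzelStep_snd q hq _ x
  rw [h1, h2]
  cases x.2 <;> simp

/-- The position of a crossing in its column in the direction of the orientation. -/
def flowHeight (c : PretzelCrossing q) : ℕ :=
  if Even c.1.val then c.2.val + 1 else (q c.1).natAbs - c.2.val

theorem flowHeight_pos (c : PretzelCrossing q) : 0 < flowHeight q c := by
  have := c.2.isLt
  unfold flowHeight; split_ifs <;> omega

/-- The passage through which a strand leaves a column. -/
def columnExit (a : Fin (n + 1) × Bool) : PretzelCrossing q × Bool :=
  (⟨a.1, ⟨if Even a.1.val then (q a.1).natAbs - 1 else 0, by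
    have := Int.natAbs_pos.2 (hq a.1); split_ifs <;> omega⟩⟩, a.2)

/-- The column and strand from which a strand enters a column. -/
def columnSource (a : Fin (n + 1) × Bool) : Fin (n + 1) × Bool :=
  (if decide (Even a.1.val) = a.2 then (finRotate (n + 1)).symm a.1 else finRotate (n + 1) a.1,
    !a.2)

theorem flowHeight_columnExit (a : Fin (n + 1) × Bool) :
    flowHeight q (columnExit q hq a).1 = (q a.1).natAbs := by
  have := Int.natAbs_pos.2 (hq a.1)
  simp only [flowHeight, columnExit]
  split_ifs <;> omega

theorem columnExit_injective : Function.Injective (columnExit q hq) := by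
  intro a b h
  exact Prod.ext (congrArg (fun x => x.1.1) h) (congrArg (fun x => x.2) h)

theorem even_finRotate_iff (hm : Even (n + 1)) (i : Fin (n + 1)) :
    Even (finRotate (n + 1) i).val ↔ ¬ Even i.val := by
  rw [← decide_eq_true_iff (p := Even (finRotate (n + 1) i).val), even_finRotate hm i]
  simp

theorem even_finRotate_symm_iff (hm : Even (n + 1)) (i : Fin (n + 1)) :
    Even ((finRotate (n + 1)).symm i).val ↔ ¬ Even i.val := by
  have := even_finRotate_iff hm ((finRotate (n + 1)).symm i)
  rw [Equiv.apply_symm_apply] at this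
  tauto

theorem even_columnSource_iff (hm : Even (n + 1)) (a : Fin (n + 1) × Bool) :
    Even (columnSource a).1.val ↔ ¬ Even a.1.val := by
  unfold columnSource
  dsimp only
  split_ifs
  exacts [even_finRotate_symm_iff hm _, even_finRotate_iff hm _]

theorem pretzelPrev_of_flowHeight_eq_one (hm : Even (n + 1)) (c : PretzelCrossing q) (r : Bool)
    (h : flowHeight q c = 1) :
    pretzelPrev q hq (c, r) = columnExit q hq (columnSource (c.1, r)) := by
  obtain ⟨i, j⟩ := c
  have hj := j.isLt
  have hsrc := even_columnSource_iff hm (i, r)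
  by_cases hi : Even i.val
  · have hj0 : ¬ 0 < j.val := by simp only [flowHeight, if_pos hi] at h; omega
    unfold pretzelPrev
    rw [pretzelStep_down_bottom q hq (by simp [hi]) j hj0 r (columnSource (i, r)).1
      (by unfold columnSource; cases r <;> simp [hi])]
    have h0 : ¬ Even (columnSource (i, r)).1.val := by rw [hsrc]; simpa using hi
    unfold columnExit
    simp only [if_neg h0]
    rfl
  · have hj0 : ¬ j.val + 1 < (q i).natAbs := by simp only [flowHeight, if_neg hi] at h; omega
    unfold pretzelPrev
    rw [pretzelStep_up_top q hq (by simp [hi]) j hj0 r (columnSource (i, r)).1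
      (by unfold columnSource; cases r <;> simp [hi])]
    have h0 : Even (columnSource (i, r)).1.val := by rw [hsrc]; exact hi
    unfold columnExit
    simp only [if_pos h0]
    rfl

theorem exists_pretzelPrev_eq (c : PretzelCrossing q) (h : flowHeight q c ≠ 1) :
    ∃ c' : PretzelCrossing q, c'.1 = c.1 ∧ flowHeight q c = flowHeight q c' + 1 ∧
      ∀ r, pretzelPrev q hq (c, r) = (c', !r) := by
  obtain ⟨i, j⟩ := c
  have hj := j.isLt
  by_cases hi : Even i.val
  · have hj0 : 0 < j.val := by simp only [flowHeight, if_pos hi] at h; omega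
    refine ⟨_, ?_, ?_, fun r => pretzelStep_down_pos q hq (by simp [hi]) j hj0 r⟩
    · rfl
    · simp only [flowHeight, if_pos hi]; omega
  · have hj0 : j.val + 1 < (q i).natAbs := by simp only [flowHeight, if_neg hi] at h; omega
    refine ⟨_, ?_, ?_, fun r => pretzelStep_up_lt q hq (by simp [hi]) j hj0 r⟩
    · rfl
    · simp only [flowHeight, if_neg hi]; omega

/-- The value of a strand of the column `i` after `k` crossings, as a function of the values at the
exits of all columns. -/
noncomputable def strandValue (z : Fin (n + 1) × Bool → ℤ[T;T⁻¹]) (i : Fin (n + 1)) (k : ℕ)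
    (r : Bool) : ℤ[T;T⁻¹] :=
  if r then z (columnSource (i, false)) +
    twist (q i) k * (z (columnSource (i, true)) - z (columnSource (i, false)))
  else z (columnSource (i, true)) -
    T 1 * twist (q i) k * (z (columnSource (i, true)) - z (columnSource (i, false)))

theorem strandValue_zero (z : Fin (n + 1) × Bool → ℤ[T;T⁻¹]) (i : Fin (n + 1)) (r : Bool) :
    strandValue q z i 0 r = z (columnSource (i, !r)) := by
  cases r <;> simp [strandValue, twist_zero]

/-- Each crossing preserves `T * rising + falling`. Only one unknown per height is left, and it
obeys the recurrence of `twist`; this lemma and the next check the two crossing relations. -/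
theorem strandValue_succ_over (z : Fin (n + 1) × Bool → ℤ[T;T⁻¹]) (i : Fin (n + 1)) (k : ℕ) :
    strandValue q z i (k + 1) (decide (0 < q i)) = strandValue q z i k (!decide (0 < q i)) := by
  by_cases h : 0 < q i
  · simp only [h, decide_true, Bool.not_true, strandValue, if_true, Bool.false_eq_true, if_false,
      twist_succ_of_pos h]
    ring
  · simp only [h, decide_false, Bool.not_false, strandValue, if_true, Bool.false_eq_true, if_false]
    linear_combination (z (columnSource (i, false)) - z (columnSource (i, true))) *
      T_mul_twist_succ_of_not_pos h k

theorem strandValue_succ_under (z : Fin (n + 1) × Bool → ℤ[T;T⁻¹]) (i : Fin (n + 1)) (k : ℕ) :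
    strandValue q z i (k + 1) (!decide (0 < q i)) =
      T (columnSign q i) * strandValue q z i k (decide (0 < q i)) +
        (1 - T (columnSign q i)) * strandValue q z i (k + 1) (decide (0 < q i)) := by
  by_cases h : 0 < q i
  · simp only [h, decide_true, Bool.not_true, strandValue, if_true, Bool.false_eq_true, if_false,
      columnSign, twist_succ_of_pos h]
    ring
  · simp only [h, decide_false, Bool.not_false, strandValue, if_true, Bool.false_eq_true, if_false,
      columnSign]
    linear_combination (z (columnSource (i, true)) - z (columnSource (i, false))) *
      (T_mul_twist_succ_of_not_pos h k +
        (twist (q i) k - twist (q i) (k + 1)) * T_one_mul_T_neg_one)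

end Pretzel

/-! ### Reduction to the exits of the columns -/

section Pretzel

variable {n : ℕ} (q : Fin (n + 1) → ℤ) (hq : ∀ i, q i ≠ 0)

/-- The relations between the strands inside the columns: the Alexander matrix, with the edges
entering a column set to zero. -/
noncomputable def columnRelations :
    (PretzelCrossing q × Bool → ℤ[T;T⁻¹]) →ₗ[ℤ[T;T⁻¹]] PretzelCrossing q × Bool → ℤ[T;T⁻¹] where
  toFun y x :=
    if x.2 = decide (0 < q x.1.1) then
      y x - if flowHeight q x.1 = 1 then 0 else y (pretzelPrev q hq x)
    else y x - T (columnSign q x.1.1) *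
        (if flowHeight q x.1 = 1 then 0 else y (pretzelPrev q hq x)) -
      (1 - T (columnSign q x.1.1)) * y (x.1, decide (0 < q x.1.1))
  map_add' y y' := by
    funext x
    simp only [Pi.add_apply]
    split_ifs <;> ring
  map_smul' a y := by
    funext x
    simp only [Pi.smul_apply, smul_eq_mul, RingHom.id_apply]
    split_ifs <;> ring

theorem columnRelations_over (y : PretzelCrossing q × Bool → ℤ[T;T⁻¹]) (c : PretzelCrossing q) :
    columnRelations q hq y (c, decide (0 < q c.1)) = y (c, decide (0 < q c.1)) -
      if flowHeight q c = 1 then 0 else y (pretzelPrev q hq (c, decide (0 < q c.1))) := by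
  simp [columnRelations]

theorem columnRelations_under (y : PretzelCrossing q × Bool → ℤ[T;T⁻¹]) (c : PretzelCrossing q) :
    columnRelations q hq y (c, !decide (0 < q c.1)) = y (c, !decide (0 < q c.1)) -
      T (columnSign q c.1) *
        (if flowHeight q c = 1 then 0 else y (pretzelPrev q hq (c, !decide (0 < q c.1)))) -
      (1 - T (columnSign q c.1)) * y (c, decide (0 < q c.1)) := by
  simp [columnRelations]

/-- The map is unitriangular when passages are ordered by height along the flow, the overpass
preceding the underpass at each crossing. -/
theorem det_columnRelations : LinearMap.det (columnRelations q hq) = 1 := by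
  rw [LinearMap.det_eq_prod_of_rank _
    (fun x => 2 * flowHeight q x.1 + if x.2 = decide (0 < q x.1.1) then 0 else 1) (fun _ => 1),
    Finset.prod_const_one]
  rintro y ⟨c, r⟩ h
  have hprev : (if flowHeight q c = 1 then 0 else y (pretzelPrev q hq (c, r))) = 0 := by
    split_ifs with h1
    · rfl
    · obtain ⟨c', h2, h3, h4⟩ := exists_pretzelPrev_eq q hq c h1
      rw [h4]
      refine h _ ?_
      dsimp only
      split_ifs <;> omega
  obtain rfl | rfl : r = decide (0 < q c.1) ∨ r = !decide (0 < q c.1) := by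
    cases r <;> cases decide (0 < q c.1) <;> simp
  · rw [columnRelations_over, hprev]; simp
  · rw [columnRelations_under, hprev, h (c, decide (0 < q c.1)) (by simp)]; simp

/-- The values of an edge labelling at the exits of the columns. -/
noncomputable def exitValues :
    (PretzelCrossing q × Bool → ℤ[T;T⁻¹]) →ₗ[ℤ[T;T⁻¹]] Fin (n + 1) × Bool → ℤ[T;T⁻¹] :=
  LinearMap.funLeft _ _ (columnExit q hq)

/-- The extension of exit values to an edge labelling satisfying the relations of all crossings,
up to a correction at the exit `(0, false)`. -/
noncomputable def strandExtension :
    (Fin (n + 1) × Bool → ℤ[T;T⁻¹]) →ₗ[ℤ[T;T⁻¹]] PretzelCrossing q × Bool → ℤ[T;T⁻¹] where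
  toFun z x := strandValue q z x.1.1 (flowHeight q x.1) x.2 -
    if x = columnExit q hq (0, false) then z (Fin.last n, false) else 0
  map_add' z z' := by
    funext x
    simp only [strandValue, Pi.add_apply]
    split_ifs <;> ring
  map_smul' a z := by
    funext x
    simp only [strandValue, Pi.smul_apply, smul_eq_mul, RingHom.id_apply]
    split_ifs <;> ring

theorem columnRelations_strandValue (y : PretzelCrossing q × Bool → ℤ[T;T⁻¹]) (hm : Even (n + 1)) :
    columnRelations q hq
        (y - fun x : PretzelCrossing q × Bool => strandValue q (exitValues q hq y) x.1.1 (flowHeight q x.1) x.2) =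
      (pretzelMatrix q hq hm).mulVec y := by
  set z := exitValues q hq y with hz
  funext ⟨c, r⟩
  have hc := flowHeight_pos q c
  have hprev : ∀ r, (if flowHeight q c = 1 then 0 else
      (y - fun x : PretzelCrossing q × Bool => strandValue q z x.1.1 (flowHeight q x.1) x.2) (pretzelPrev q hq (c, r))) =
      y (pretzelPrev q hq (c, r)) - strandValue q z c.1 (flowHeight q c - 1) (!r) := by
    intro r
    split_ifs with h1
    · rw [pretzelPrev_of_flowHeight_eq_one q hq hm c r h1, h1, strandValue_zero, hz, exitValues,
        LinearMap.funLeft_apply, Bool.not_not, sub_self]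
    · obtain ⟨c', h2, h3, h4⟩ := exists_pretzelPrev_eq q hq c h1
      rw [h4, Pi.sub_apply, h2, h3, Nat.add_sub_cancel]
  obtain ⟨k, hk⟩ : ∃ k, flowHeight q c = k + 1 := ⟨_, (Nat.sub_add_cancel hc).symm⟩
  obtain rfl | rfl : r = decide (0 < q c.1) ∨ r = !decide (0 < q c.1) := by
    cases r <;> cases decide (0 < q c.1) <;> simp
  · rw [columnRelations_over, hprev, pretzelMatrix_mulVec_over, hk, Pi.sub_apply]
    dsimp only
    rw [hk, strandValue_succ_over, Nat.add_sub_cancel]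
    ring
  · rw [columnRelations_under, hprev, pretzelMatrix_mulVec_under, hk, Pi.sub_apply, Pi.sub_apply]
    dsimp only
    rw [hk, strandValue_succ_under, Nat.add_sub_cancel, Bool.not_not]
    ring

/-- This exit is at the end of its column, so no passage inside the column follows it; as `q 0 > 0`,
it is an underpass, so it is not the overpassing edge of a relation either. -/
theorem columnRelations_single (h0 : 0 < q 0) (a : ℤ[T;T⁻¹]) :
    columnRelations q hq (Pi.single (columnExit q hq (0, false)) a) =
      Pi.single (columnExit q hq (0, false)) a := by
  funext ⟨c, r⟩
  have hprev : (if flowHeight q c = 1 then 0 else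
      (Pi.single (columnExit q hq (0, false)) a : PretzelCrossing q × Bool → ℤ[T;T⁻¹])
        (pretzelPrev q hq (c, r))) = 0 := by
    split_ifs with h1
    · rfl
    · obtain ⟨⟨i', j'⟩, h2, h3, h4⟩ := exists_pretzelPrev_eq q hq c h1
      rw [h4, Pi.single_eq_of_ne]
      intro e
      have h5 := congrArg (fun x => flowHeight q x.1) e
      dsimp only at h5 h2
      rw [flowHeight_columnExit] at h5
      have h6 : i' = 0 := congrArg (fun x => x.1.1) e
      obtain ⟨i, j⟩ := c
      dsimp only at h2
      subst h2
      have : flowHeight q ⟨i', j⟩ ≤ (q i').natAbs := by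
        have := j.isLt
        simp only [flowHeight]; split_ifs <;> omega
      rw [h3, h5, h6] at this
      exact absurd this (Nat.not_succ_le_self _)
  obtain rfl | rfl : r = decide (0 < q c.1) ∨ r = !decide (0 < q c.1) := by
    cases r <;> cases decide (0 < q c.1) <;> simp
  · rw [columnRelations_over, hprev]; simp
  · rw [columnRelations_under, hprev, mul_zero, sub_zero,
      Pi.single_eq_of_ne (i' := (c, decide (0 < q c.1))), mul_zero, sub_zero]
    intro e
    have h1 : c.1 = 0 := congrArg (fun x => x.1.1) e
    have h2 : decide (0 < q c.1) = false := congrArg (fun x => x.2) e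
    rw [h1] at h2
    simp [h0] at h2

/-- An edge labelling satisfies all relations exactly if it is the extension of its own exit values.
The added matrix unit becomes the correction term of `strandExtension`. -/
theorem toLin_pretzelMatrix_add_single (hm : Even (n + 1)) (h0 : 0 < q 0) :
    Matrix.toLin' (pretzelMatrix q hq hm +
      Matrix.single (columnExit q hq (0, false)) (columnExit q hq (Fin.last n, false)) 1) =
      columnRelations q hq ∘ₗ (1 - strandExtension q hq ∘ₗ exitValues q hq) := by
  refine LinearMap.ext fun y => ?_
  have h1 : (1 - strandExtension q hq ∘ₗ exitValues q hq) y =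
      (y - fun x : PretzelCrossing q × Bool => strandValue q (exitValues q hq y) x.1.1 (flowHeight q x.1) x.2) +
        Pi.single (columnExit q hq (0, false)) (y (columnExit q hq (Fin.last n, false))) := by
    funext x
    simp only [LinearMap.sub_apply, Module.End.one_apply, LinearMap.comp_apply, strandExtension,
      LinearMap.coe_mk, AddHom.coe_mk, Pi.sub_apply, Pi.add_apply, Pi.single_apply]
    exact (sub_add _ _ _).symm
  rw [LinearMap.comp_apply, h1, map_add (columnRelations q hq), columnRelations_strandValue q hq y hm,
    columnRelations_single q hq h0, Matrix.toLin'_apply, Matrix.add_mulVec,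
    Matrix.single_mulVec]
  simp [Pi.single]

/-- The relations between the exit values of the columns, one of them being modified. -/
noncomputable def exitRelations (g : Fin (n + 1) → ℤ[T;T⁻¹]) :
    (Fin (n + 1) × Bool → ℤ[T;T⁻¹]) →ₗ[ℤ[T;T⁻¹]] Fin (n + 1) × Bool → ℤ[T;T⁻¹] where
  toFun z a :=
    let l := z (columnSource (a.1, true))
    let r := z (columnSource (a.1, false))
    z a - (if a.2 then r + g a.1 * (l - r) else l - T 1 * g a.1 * (l - r)) +
      if a = (0, false) then z (Fin.last n, false) else 0
  map_add' z z' := by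
    funext x
    simp only [Pi.add_apply]
    split_ifs <;> ring
  map_smul' a z := by
    funext x
    simp only [Pi.smul_apply, smul_eq_mul, RingHom.id_apply]
    split_ifs <;> ring

theorem one_sub_exitValues_comp :
    1 - exitValues q hq ∘ₗ strandExtension q hq =
      exitRelations fun i => twist (q i) (q i).natAbs := by
  refine LinearMap.ext fun z => funext fun a => ?_
  simp only [LinearMap.sub_apply, Module.End.one_apply, LinearMap.comp_apply, Pi.sub_apply,
    exitValues, LinearMap.funLeft_apply, strandExtension, exitRelations,
    LinearMap.coe_mk, AddHom.coe_mk, flowHeight_columnExit, (columnExit_injective q hq).eq_iff]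
  exact (sub_add _ _ _).symm

theorem det_pretzelMatrix (hm : Even (n + 1)) :
    (pretzelMatrix q hq hm).det = 0 :=
  Matrix.exists_mulVec_eq_zero_iff.1
    ⟨1, fun h => one_ne_zero (congrFun h (columnExit q hq (0, false))), pretzelMatrix_mulVec_one q hq hm⟩

/-- One cofactor is `det (1 - E R)`, with `R` the restriction to exits and `E` the extension. By
Sylvester's identity it equals `det (1 - R E)`, which has only two unknowns per column. -/
theorem dvd_adjugate_alexanderMatrix_pretzel (hm : Even (n + 1)) (h0 : 0 < q 0)
    (Q : ℤ[T;T⁻¹]) :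
    (∀ i j, Q ∣ (pretzelDiagram q hq hm).alexanderMatrix.adjugate i j) ↔
      Q ∣ LinearMap.det (exitRelations fun i => twist (q i) (q i).natAbs) := by
  have h1 := Matrix.det_add_single (pretzelMatrix q hq hm) (columnExit q hq (Fin.last n, false))
    (columnExit q hq (0, false))
  rw [← LinearMap.det_toLin', toLin_pretzelMatrix_add_single q hq hm h0, LinearMap.det_comp,
    det_columnRelations, one_mul, LinearMap.det_one_sub_comp_comm, one_sub_exitValues_comp,
    det_pretzelMatrix, zero_add] at h1
  rw [h1]
  exact Matrix.dvd_adjugate_iff (pretzelMatrix_mulVec_one q hq hm) (isUnit_relationWeight q)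
    (relationWeight_vecMul q hq hm) _ _ Q

end Pretzel

/-! ### Elimination around the ring of columns -/

section Chain

variable {n : ℕ}

theorem val_finRotate_symm {i : Fin (n + 1)} (hi : i ≠ 0) :
    ((finRotate (n + 1)).symm i).val + 1 = i.val := by
  have h := coe_finRotate ((finRotate (n + 1)).symm i)
  rw [Equiv.apply_symm_apply] at h
  split_ifs at h with h1
  · exact absurd (Fin.ext h) hi
  · exact h.symm

theorem finRotate_symm_zero : (finRotate (n + 1)).symm 0 = Fin.last n := by
  rw [Equiv.symm_apply_eq, finRotate_last]

/-- The values of the arcs below the columns in terms of chain coordinates. -/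
def chainBot (ξ : Fin (n + 1) × Bool → ℤ[T;T⁻¹]) (i : Fin (n + 1)) : ℤ[T;T⁻¹] :=
  if i = Fin.last n then ξ (0, false) else ξ (i, true)

/-- The differences between the values of the arcs above and below the columns in terms of chain
coordinates. -/
def chainGap (ξ : Fin (n + 1) × Bool → ℤ[T;T⁻¹]) (i : Fin (n + 1)) : ℤ[T;T⁻¹] :=
  if i = 0 then ξ (Fin.last n, true) else ξ (i, false)

/-- The change of variables from chain coordinates to exit values. -/
noncomputable def ofChain :
    (Fin (n + 1) × Bool → ℤ[T;T⁻¹]) →ₗ[ℤ[T;T⁻¹]] Fin (n + 1) × Bool → ℤ[T;T⁻¹] where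
  toFun ξ a :=
    let p := (finRotate (n + 1)).symm a.1
    if Even a.1.val then
      if a.2 then chainBot ξ a.1 + chainGap ξ a.1 else chainBot ξ p + chainGap ξ p
    else if a.2 then chainBot ξ p else chainBot ξ a.1
  map_add' ξ ξ' := by
    funext a
    simp only [chainBot, chainGap, Pi.add_apply]
    split_ifs <;> ring
  map_smul' c ξ := by
    funext a
    simp only [chainBot, chainGap, Pi.smul_apply, smul_eq_mul, RingHom.id_apply]
    split_ifs <;> ring

/-- The change of variables from exit values to chain coordinates. -/
noncomputable def toChain :
    (Fin (n + 1) × Bool → ℤ[T;T⁻¹]) →ₗ[ℤ[T;T⁻¹]] Fin (n + 1) × Bool → ℤ[T;T⁻¹] where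
  toFun z a :=
    let top (i : Fin (n + 1)) := if Even i.val then z (i, true) else z (finRotate (n + 1) i, false)
    let bot (i : Fin (n + 1)) := if Even i.val then z (finRotate (n + 1) i, true) else z (i, false)
    if a.2 then if a.1 = Fin.last n then top 0 - bot 0 else bot a.1
    else if a.1 = 0 then bot (Fin.last n) else top a.1 - bot a.1
  map_add' z z' := by
    funext a
    simp only [Pi.add_apply]
    split_ifs <;> ring
  map_smul' c z := by
    funext a
    simp only [Pi.smul_apply, smul_eq_mul, RingHom.id_apply]
    split_ifs <;> ring

theorem chainBot_toChain (z : Fin (n + 1) × Bool → ℤ[T;T⁻¹]) (i : Fin (n + 1)) :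
    chainBot (toChain z) i =
      if Even i.val then z (finRotate (n + 1) i, true) else z (i, false) := by
  by_cases h : i = Fin.last n
  · subst h; simp only [chainBot, toChain, LinearMap.coe_mk, AddHom.coe_mk, if_true]; rfl
  · simp only [chainBot, toChain, LinearMap.coe_mk, AddHom.coe_mk, if_neg h]; rfl

theorem chainGap_toChain (z : Fin (n + 1) × Bool → ℤ[T;T⁻¹]) (i : Fin (n + 1)) :
    chainGap (toChain z) i =
      (if Even i.val then z (i, true) else z (finRotate (n + 1) i, false)) -
      if Even i.val then z (finRotate (n + 1) i, true) else z (i, false) := by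
  by_cases h : i = 0
  · subst h; simp only [chainGap, toChain, LinearMap.coe_mk, AddHom.coe_mk, if_true]
  · simp only [chainGap, toChain, LinearMap.coe_mk, AddHom.coe_mk, if_neg h]; rfl

theorem isUnit_det_ofChain (hm : Even (n + 1)) :
    IsUnit (LinearMap.det (ofChain (n := n))) := by
  refine IsUnit.of_mul_eq_one (LinearMap.det (toChain (n := n))) ?_
  rw [← LinearMap.det_comp]
  have : ofChain (n := n) ∘ₗ toChain = LinearMap.id := by
    refine LinearMap.ext fun z => funext fun ⟨i, r⟩ => ?_
    have hp := even_finRotate_symm_iff hm i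
    simp only [LinearMap.comp_apply, ofChain, LinearMap.coe_mk, AddHom.coe_mk, chainBot_toChain,
      chainGap_toChain, Equiv.apply_symm_apply, hp, LinearMap.id_apply]
    by_cases hi : Even i.val <;> cases r <;> simp only [hi, not_true, not_false_iff, if_true,
      if_false, Bool.false_eq_true] <;> ring
  rw [this, LinearMap.det_id]

/-- Row operations on the relations between exit values. -/
noncomputable def rowReduction :
    (Fin (n + 1) × Bool → ℤ[T;T⁻¹]) →ₗ[ℤ[T;T⁻¹]] Fin (n + 1) × Bool → ℤ[T;T⁻¹] where
  toFun ρ a :=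
    if a.2 then ρ a
    else if a.1 = 0 then ∑ i, (ρ (i, false) + T 1 * ρ (i, true))
    else ρ (a.1, false) + T 1 * ρ (a.1, true)
  map_add' ρ ρ' := by
    funext a
    simp only [Pi.add_apply]
    split_ifs
    · rfl
    · rw [← Finset.sum_add_distrib]
      exact Finset.sum_congr rfl fun i _ => by ring
    · ring
  map_smul' c ρ := by
    funext a
    simp only [Pi.smul_apply, smul_eq_mul, RingHom.id_apply]
    split_ifs
    · rfl
    · rw [Finset.mul_sum]
      exact Finset.sum_congr rfl fun i _ => by ring
    · ring

theorem det_rowReduction : LinearMap.det (rowReduction (n := n)) = 1 := by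
  rw [LinearMap.det_eq_prod_of_rank _
    (fun a => if a.2 then 0 else if a.1 = 0 then 2 else 1) (fun _ => 1), Finset.prod_const_one]
  rintro ρ ⟨i, r⟩ h
  cases r
  · have ht : ∀ j, ρ (j, true) = 0 := fun j => h _ (by simp only [if_true]; split_ifs <;> simp_all)
    by_cases hi : i = 0
    · subst hi
      have hf : ∀ j, j ≠ 0 → ρ (j, false) = 0 := fun j hj => h _ (by simp [hj])
      simp only [rowReduction, LinearMap.coe_mk, AddHom.coe_mk, if_true, ht, mul_zero, add_zero,
        Bool.false_eq_true, if_false, one_mul]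
      exact Finset.sum_eq_single _ (fun j _ hj => hf j hj) (by simp)
    · simp [rowReduction, hi, ht]
  · simp [rowReduction]

/-- The reduced relations in chain coordinates, the last one being replaced by a coordinate. -/
noncomputable def chainRelations (g : Fin (n + 1) → ℤ[T;T⁻¹]) :
    (Fin (n + 1) × Bool → ℤ[T;T⁻¹]) →ₗ[ℤ[T;T⁻¹]] Fin (n + 1) × Bool → ℤ[T;T⁻¹] where
  toFun ξ a :=
    let p := (finRotate (n + 1)).symm a.1
    let i := a.1
    if a.2 then
      if i = Fin.last n then ξ (Fin.last n, true)
      else if Even i.val then chainGap ξ i - g i * (chainBot ξ p - chainBot ξ i)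
      else -chainGap ξ p - g i * (chainGap ξ i - chainGap ξ p - (chainBot ξ p - chainBot ξ i))
    else if i = 0 then ξ (0, false)
    else if Even i.val then chainGap ξ p + T 1 * chainGap ξ i
    else -(chainGap ξ i + T 1 * chainGap ξ p)
  map_add' ξ ξ' := by
    have h1 : ∀ i, chainBot (ξ + ξ') i = chainBot ξ i + chainBot ξ' i := fun i => by
      simp only [chainBot, Pi.add_apply]; split_ifs <;> rfl
    have h2 : ∀ i, chainGap (ξ + ξ') i = chainGap ξ i + chainGap ξ' i := fun i => by
      simp only [chainGap, Pi.add_apply]; split_ifs <;> rfl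
    funext a
    simp only [Pi.add_apply, h1, h2]
    split_ifs <;> ring
  map_smul' c ξ := by
    have h1 : ∀ i, chainBot (c • ξ) i = c * chainBot ξ i := fun i => by
      simp only [chainBot, Pi.smul_apply, smul_eq_mul]; split_ifs <;> rfl
    have h2 : ∀ i, chainGap (c • ξ) i = c * chainGap ξ i := fun i => by
      simp only [chainGap, Pi.smul_apply, smul_eq_mul]; split_ifs <;> rfl
    funext a
    simp only [Pi.smul_apply, smul_eq_mul, RingHom.id_apply, h1, h2]
    split_ifs <;> ring

theorem not_even_last (hm : Even (n + 1)) : ¬ Even (Fin.last n).val := by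
  rw [Fin.val_last]
  exact Nat.even_add_one.1 hm

theorem ofChain_apply_columnSource (hm : Even (n + 1)) (ξ : Fin (n + 1) × Bool → ℤ[T;T⁻¹])
    (i : Fin (n + 1)) (r : Bool) :
    ofChain ξ (columnSource (i, r)) =
      let p := (finRotate (n + 1)).symm i
      if Even i.val then if r then chainBot ξ p else chainBot ξ i
      else if r then chainBot ξ i + chainGap ξ i else chainBot ξ p + chainGap ξ p := by
  have hp := even_finRotate_symm_iff hm i
  have hn := even_finRotate_iff hm i
  by_cases hi : Even i.val <;> cases r <;>
    simp only [hi, not_true, not_false_iff, iff_true, iff_false] at hp hn <;>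
    simp only [columnSource, ofChain, LinearMap.coe_mk, AddHom.coe_mk, hi, hp, hn, decide_true,
      decide_false, if_true, if_false, Bool.false_eq_true, Bool.not_true, Bool.not_false,
      reduceCtorEq, Equiv.symm_apply_apply]

theorem exitRelations_ofChain (hm : Even (n + 1)) (g : Fin (n + 1) → ℤ[T;T⁻¹])
    (ξ : Fin (n + 1) × Bool → ℤ[T;T⁻¹]) (i : Fin (n + 1)) (r : Bool) :
    exitRelations g (ofChain ξ) (i, r) =
      let p := (finRotate (n + 1)).symm i
      (if Even i.val then
        if r then chainGap ξ i - g i * (chainBot ξ p - chainBot ξ i)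
        else chainGap ξ p + T 1 * g i * (chainBot ξ p - chainBot ξ i)
      else if r then
        -chainGap ξ p - g i * (chainGap ξ i - chainGap ξ p - (chainBot ξ p - chainBot ξ i))
      else -chainGap ξ i +
        T 1 * g i * (chainGap ξ i - chainGap ξ p - (chainBot ξ p - chainBot ξ i))) +
      if (i, r) = (0, false) then ξ (0, false) else 0 := by
  have hlast : ofChain ξ (Fin.last n, false) = ξ (0, false) := by
    simp [ofChain, not_even_last hm, chainBot, -Fin.val_last]
  simp only [exitRelations, LinearMap.coe_mk, AddHom.coe_mk, ofChain_apply_columnSource hm, hlast]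
  congr 1
  simp only [ofChain, LinearMap.coe_mk, AddHom.coe_mk]
  by_cases hi : Even i.val <;> cases r <;> simp only [hi, if_true, if_false, Bool.false_eq_true] <;>
    ring

theorem rowReduction_exitRelations_true (hm : Even (n + 1)) (g : Fin (n + 1) → ℤ[T;T⁻¹])
    (ξ : Fin (n + 1) × Bool → ℤ[T;T⁻¹]) (i : Fin (n + 1)) :
    rowReduction (exitRelations g (ofChain ξ)) (i, true) =
      let p := (finRotate (n + 1)).symm i
      if Even i.val then chainGap ξ i - g i * (chainBot ξ p - chainBot ξ i)
      else -chainGap ξ p - g i * (chainGap ξ i - chainGap ξ p - (chainBot ξ p - chainBot ξ i)) := by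
  have : rowReduction (exitRelations g (ofChain ξ)) (i, true) =
    exitRelations g (ofChain ξ) (i, true) := by simp [rowReduction]
  rw [this, exitRelations_ofChain hm]
  simp

theorem rowReduction_exitRelations (hm : Even (n + 1)) (g : Fin (n + 1) → ℤ[T;T⁻¹])
    (ξ : Fin (n + 1) × Bool → ℤ[T;T⁻¹]) (a : Fin (n + 1) × Bool) (ha : a ≠ (Fin.last n, true)) :
    (rowReduction ∘ₗ exitRelations g ∘ₗ ofChain) ξ a = chainRelations g ξ a := by
  obtain ⟨i, r⟩ := a
  rw [LinearMap.comp_apply, LinearMap.comp_apply]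
  have hrow : ∀ i, exitRelations g (ofChain ξ) (i, false) +
      T 1 * exitRelations g (ofChain ξ) (i, true) =
      (if Even i.val then chainGap ξ ((finRotate (n + 1)).symm i) + T 1 * chainGap ξ i
      else -(chainGap ξ i + T 1 * chainGap ξ ((finRotate (n + 1)).symm i))) +
        if i = 0 then ξ (0, false) else 0 := by
    intro i
    rw [exitRelations_ofChain hm, exitRelations_ofChain hm]
    simp only [Prod.mk.injEq, and_true, reduceCtorEq, and_false, if_false, if_true,
      Bool.false_eq_true]
    split_ifs <;> ring
  cases r
  · by_cases hi : i = 0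
    · subst hi
      simp only [rowReduction, chainRelations, LinearMap.coe_mk, AddHom.coe_mk, if_true,
        Bool.false_eq_true, if_false, hrow]
      -- The conserved combination of each column is a difference of consecutive values of `ψ`,
      -- because the parities of the columns alternate. The total over the cyclic ring vanishes, and
      -- only the correction term survives.
      let ψ : Fin (n + 1) → ℤ[T;T⁻¹] := fun j =>
        if Even j.val then T 1 * chainGap ξ j else -chainGap ξ j
      have hψ : ∀ i : Fin (n + 1), (if Even i.val then
          chainGap ξ ((finRotate (n + 1)).symm i) + T 1 * chainGap ξ i
          else -(chainGap ξ i + T 1 * chainGap ξ ((finRotate (n + 1)).symm i))) =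
          ψ i - ψ ((finRotate (n + 1)).symm i) := by
        intro i
        have hp := even_finRotate_symm_iff hm i
        by_cases hi : Even i.val <;> simp only [hi, not_true, not_false_iff, iff_true, iff_false]
          at hp <;> simp only [ψ, hi, hp, if_true, if_false] <;> ring
      rw [Finset.sum_add_distrib, Finset.sum_congr rfl fun i _ => hψ i, Finset.sum_sub_distrib,
        Equiv.sum_comp (finRotate (n + 1)).symm ψ, sub_self, zero_add]
      simp
    · simp only [rowReduction, chainRelations, LinearMap.coe_mk, AddHom.coe_mk, if_neg hi,
        Bool.false_eq_true, if_false, hrow, add_zero]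
  · have hi : i ≠ Fin.last n := fun h => ha (by rw [h])
    rw [rowReduction_exitRelations_true hm]
    simp only [chainRelations, LinearMap.coe_mk, AddHom.coe_mk, if_neg hi, if_true]

/-- The system is triangular: first the bottom value of the last arc and the gap of arc `0`, then
the gaps from left to right, then the remaining bottom values. Only the last group has non-unit
diagonal entries, namely `± g i`. -/
theorem det_chainRelations (g : Fin (n + 1) → ℤ[T;T⁻¹]) :
    Associated (LinearMap.det (chainRelations g)) (∏ i : Fin n, g i.castSucc) := by
  rw [LinearMap.det_eq_prod_of_rank _
    (fun a => if a.2 then if a.1 = Fin.last n then 0 else n + 2 + a.1.val else a.1.val)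
    (fun a => if a.2 then if a.1 = Fin.last n then 1 else if Even a.1.val then g a.1 else -g a.1
      else if a.1 = 0 then 1 else if Even a.1.val then T 1 else -1)]
  · rw [Fintype.prod_prod_type]
    simp only [Fintype.prod_bool, if_true, Bool.false_eq_true, if_false]
    rw [Finset.prod_mul_distrib]
    have h1 : IsUnit (∏ i : Fin (n + 1), if i = 0 then 1 else if Even i.val then T 1 else
        (-1 : ℤ[T;T⁻¹])) := by
      refine IsUnit.prod_univ_iff.2 fun i => ?_
      split_ifs
      exacts [isUnit_one, isUnit_T 1, isUnit_one.neg]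
    rw [associated_mul_isUnit_left_iff h1, Fin.prod_univ_castSucc, if_pos rfl, mul_one]
    refine Associated.prod _ _ _ fun i _ => ?_
    rw [if_neg (Fin.castSucc_lt_last i).ne]
    split_ifs
    exacts [Associated.refl _, (Associated.refl _).neg_left]
  · rintro ξ ⟨i, r⟩ h
    cases r
    · by_cases hi : i = 0
      · simp [chainRelations, hi]
      · have hp := val_finRotate_symm hi
        have h1 : chainGap ξ ((finRotate (n + 1)).symm i) = 0 := by
          unfold chainGap
          split_ifs <;> refine h _ ?_ <;> simp only [if_true, Bool.false_eq_true, if_false] <;> omega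
        have h2 : chainGap ξ i = ξ (i, false) := if_neg hi
        simp only [chainRelations, LinearMap.coe_mk, AddHom.coe_mk, if_neg hi, h1, h2,
          Bool.false_eq_true, if_false]
        split_ifs <;> ring
    · by_cases hi : i = Fin.last n
      · simp [chainRelations, hi]
      · have h1 : ∀ j, chainGap ξ j = 0 := by
          intro j
          have := j.isLt
          unfold chainGap
          split_ifs <;> refine h _ ?_ <;>
            simp only [if_true, Bool.false_eq_true, if_false, if_neg hi] <;> lia
        have h2 : chainBot ξ i = ξ (i, true) := if_neg hi
        have h3 : chainBot ξ ((finRotate (n + 1)).symm i) = 0 := by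
          by_cases hi0 : i = 0
          · rw [hi0, finRotate_symm_zero, chainBot, if_pos rfl]
            refine h _ ?_
            simp only [if_true, Bool.false_eq_true, if_false, if_neg hi, Fin.val_zero]
            lia
          · have hp := val_finRotate_symm hi0
            have hl : (finRotate (n + 1)).symm i ≠ Fin.last n := by
              intro e
              have := i.isLt
              rw [e, Fin.val_last] at hp
              lia
            rw [chainBot, if_neg hl]
            refine h _ ?_
            simp only [if_true, if_neg hi, if_neg hl]
            lia
        simp only [chainRelations, LinearMap.coe_mk, AddHom.coe_mk, if_neg hi, h1, h2, h3, if_true]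
        split_ifs <;> ring

/-- The factor of a column in the Alexander polynomial of a pretzel link. -/
noncomputable def columnFactor (g : Fin (n + 1) → ℤ[T;T⁻¹]) (i : Fin (n + 1)) : ℤ[T;T⁻¹] :=
  if Even i.val then 1 else 1 - (1 + T 1) * g i

/-- The reduced system differs from the triangular one only in its last row, so one vector solving
all other rows gives the determinant by Cramer's rule. -/
theorem det_exitRelations (hm : Even (n + 1)) (g : Fin (n + 1) → ℤ[T;T⁻¹]) (hg : ∀ i, g i ≠ 0) :
    Associated (LinearMap.det (exitRelations g))
      (∑ i, columnFactor g i * ∏ j ∈ Finset.univ.erase i, g j) := by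
  set P : Fin (n + 1) → ℤ[T;T⁻¹] := fun i => ∏ j ∈ Finset.univ.erase i, g j with hP
  set s := ∏ i, g i with hs
  have hgP : ∀ i, g i * P i = s := fun i => Finset.mul_prod_erase _ _ (Finset.mem_univ i)
  let e : ℕ → ℤ[T;T⁻¹] := fun j => if h : j < n + 1 then columnFactor g ⟨j, h⟩ * P ⟨j, h⟩ else 0
  have he : ∀ i : Fin (n + 1), e i.val = columnFactor g i * P i := fun i => dif_pos i.isLt
  let β : ℕ → ℤ[T;T⁻¹] := fun k => ∑ j ∈ Finset.range k, e j
  have hβ : ∀ i : Fin (n + 1), β (i.val + 1) = β i.val + columnFactor g i * P i := fun i => by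
    rw [← he]; exact Finset.sum_range_succ _ _
  -- The solution by hand: the relations force the gaps to alternate between `s` and `-T s`, and
  -- each column then lowers the bottom value by `columnFactor g i * P i`. Scaling by `s = ∏ g`
  -- clears the denominators; the last row measures the failure to close up.
  let ξ : Fin (n + 1) × Bool → ℤ[T;T⁻¹] := fun a =>
    if a.2 then if a.1 = Fin.last n then s else -β (a.1.val + 1)
    else if a.1 = 0 then 0 else if Even a.1.val then s else -(T 1 * s)
  have hgap : ∀ i : Fin (n + 1), chainGap ξ i = if Even i.val then s else -(T 1 * s) := by
    intro i
    unfold chainGap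
    by_cases hi : i = 0
    · simp [ξ, hi]
    · simp only [ξ, if_neg hi, Bool.false_eq_true, if_false]
  have hbot : ∀ i : Fin (n + 1), i ≠ Fin.last n → chainBot ξ i = -β (i.val + 1) := by
    intro i hi
    simp only [chainBot, ξ, if_neg hi, if_true]
  have hlast : chainBot ξ (Fin.last n) = 0 := by
    simp [chainBot, ξ]
  have hbotp : ∀ i : Fin (n + 1), chainBot ξ ((finRotate (n + 1)).symm i) = -β i.val := by
    intro i
    by_cases hi : i = 0
    · rw [hi, finRotate_symm_zero, hlast]
      simp [β]
    · have hp := val_finRotate_symm hi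
      rw [hbot, hp]
      intro e
      have := i.isLt
      rw [e, Fin.val_last] at hp
      omega
  have hξ : chainRelations g ξ = Pi.single (Fin.last n, true) s := by
    funext ⟨i, r⟩
    have hp := even_finRotate_symm_iff hm i
    cases r
    · rw [Pi.single_eq_of_ne (by simp)]
      by_cases hi0 : i = 0
      · simp [chainRelations, hi0, ξ]
      · by_cases hi : Even i.val <;> simp only [hi, not_true, not_false_iff, iff_true, iff_false]
          at hp <;>
        simp only [chainRelations, LinearMap.coe_mk, AddHom.coe_mk, if_neg hi0, hgap, hi, hp,
          if_true, if_false, Bool.false_eq_true] <;> ring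
    · by_cases hl : i = Fin.last n
      · subst hl
        simp [chainRelations, ξ]
      · rw [Pi.single_eq_of_ne (by simp [hl])]
        by_cases hi : Even i.val <;> simp only [hi, not_true, not_false_iff, iff_true, iff_false]
          at hp <;>
        simp only [chainRelations, LinearMap.coe_mk, AddHom.coe_mk, if_neg hl, hgap, hi, hp,
          if_true, if_false, hbotp, hbot i hl, hβ, columnFactor]
        · linear_combination -hgP i
        · linear_combination (1 - (1 + T 1) * g i) * hgP i
  have key := LinearMap.det_mul_eq_of_forall_ne (rowReduction ∘ₗ exitRelations g ∘ₗ ofChain)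
    (chainRelations g) (Fin.last n, true) (fun y a ha => rowReduction_exitRelations hm g y a ha)
    ξ s hξ
  have hval : (rowReduction ∘ₗ exitRelations g ∘ₗ ofChain) ξ (Fin.last n, true) =
      -(g (Fin.last n) * β (n + 1)) := by
    have hp := even_finRotate_symm_iff hm (Fin.last n)
    have hl := not_even_last hm
    simp only [hl, not_false_iff, iff_true] at hp
    have h1 := hβ (Fin.last n)
    simp only [columnFactor, if_neg hl] at h1
    have h2 := rowReduction_exitRelations_true hm g ξ (Fin.last n)
    simp only [if_neg hl, hgap, hp, if_true, hbotp, hlast] at h2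
    refine h2.trans ?_
    rw [Fin.val_last] at h1 ⊢
    rw [h1]
    linear_combination (1 - (1 + T 1) * g (Fin.last n)) * hgP (Fin.last n)
  have hsum : β (n + 1) = ∑ i, columnFactor g i * P i := by
    simp only [β]
    rw [← Fin.sum_univ_eq_sum_range]
    exact Finset.sum_congr rfl fun i _ => he i
  rw [hval, hsum, LinearMap.det_comp, LinearMap.det_comp, det_rowReduction, one_mul] at key
  have hs0 : s ≠ 0 := Finset.prod_ne_zero_iff.2 fun i _ => hg i
  have h1 : Associated (LinearMap.det (exitRelations g) * s)
      ((∑ i, columnFactor g i * P i) * s) := by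
    refine ((associated_mul_isUnit_left_iff (isUnit_det_ofChain hm)).2
      (Associated.refl _)).symm.trans ?_
    rw [mul_right_comm, key]
    have h2 := (det_chainRelations g).mul_right (-(g (Fin.last n) * ∑ i, columnFactor g i * P i))
    refine h2.trans ?_
    have h3 : (∏ i : Fin n, g i.castSucc) * -(g (Fin.last n) * ∑ i, columnFactor g i * P i) =
        -((∑ i, columnFactor g i * P i) * s) := by
      rw [hs, Fin.prod_univ_castSucc]; ring
    rw [h3]
    exact (Associated.refl _).neg_left
  exact h1.of_mul_right (Associated.refl _) hs0

end Chain

/-! ### Mahler measure, units and sign change -/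

section Mahler

/-- Clearing powers of `X`, which have measure `1`, leaves an integer cofactor, whose measure is at
least `1`. -/
theorem mahlerMeasure_le_of_toLaurent_dvd {P Q : ℤ[X]} (hQ : Q ≠ 0)
    (h : toLaurent P ∣ toLaurent Q) :
    (P.map (Int.castRingHom ℂ)).mahlerMeasure ≤ (Q.map (Int.castRingHom ℂ)).mahlerMeasure := by
  obtain ⟨f, hf⟩ := h
  obtain ⟨n, f', hf'⟩ := LaurentPolynomial.exists_T_pow f
  have h1 : Q * X ^ n = P * f' := by
    apply toLaurent_injective
    rw [map_mul, map_mul, hf, hf', toLaurent_X_pow, mul_assoc]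
  have h2 : (Q.map (Int.castRingHom ℂ)).mahlerMeasure =
      (P.map (Int.castRingHom ℂ)).mahlerMeasure * (f'.map (Int.castRingHom ℂ)).mahlerMeasure := by
    have hX : ((X : ℂ[X]) ^ n).mahlerMeasure = 1 := by
      rw [mahlerMeasure_eq_leadingCoeff_mul_prod_roots]
      simp [Multiset.map_nsmul, Multiset.prod_nsmul]
    rw [← mahlerMeasure_mul, ← Polynomial.map_mul, ← h1, Polynomial.map_mul, mahlerMeasure_mul,
      Polynomial.map_pow, map_X, hX, mul_one]
  have h3 : f' ≠ 0 := by
    rintro rfl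
    rw [mul_zero] at h1
    exact mul_ne_zero hQ (pow_ne_zero _ X_ne_zero) h1
  rw [h2]
  exact le_mul_of_one_le_right (mahlerMeasure_nonneg _) (one_le_mahlerMeasure_of_ne_zero h3)

theorem mahlerMeasure_comp_neg_X (p : ℂ[X]) :
    (p.comp (-X)).mahlerMeasure = p.mahlerMeasure := by
  rw [mahlerMeasure_eq_leadingCoeff_mul_prod_roots, mahlerMeasure_eq_leadingCoeff_mul_prod_roots,
    roots_comp_neg_X, Multiset.map_map, comp_neg_X_leadingCoeff_eq]
  simp

end Mahler

/-! ### Alexander polynomials as star polynomials -/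

section Star

theorem sum_comp {ι : Type*} (s : Finset ι) (f : ι → ℤ[X]) (p : ℤ[X]) :
    (∑ i ∈ s, f i).comp p = ∑ i ∈ s, (f i).comp p :=
  map_sum (compRingHom p) f s

/-- The polynomial `[p] = 1 + X + ⋯ + X ^ (p - 1)`. -/
noncomputable def qInt (p : ℕ) : ℤ[X] := ∑ i ∈ Finset.range p, X ^ i

/-- The Coxeter polynomial of the star-shaped tree with arms of the given lengths, the centre being
counted in each arm. -/
noncomputable def starPolynomial : List ℕ → ℤ[X]
  | [] => X + 1
  | p :: l => qInt p * starPolynomial l + (1 - qInt p) * (l.map qInt).prod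

/-- The sum of the products of all but one of the values of a function. -/
def omitSum {R : Type*} [CommRing R] {m : ℕ} (f : Fin m → R) : R :=
  ∑ i, ∏ j, if j = i then 1 else f j

theorem omitSum_eq_sum_erase {R : Type*} [CommRing R] {m : ℕ} (f : Fin m → R) :
    omitSum f = ∑ i, ∏ j ∈ Finset.univ.erase i, f j := by
  refine Finset.sum_congr rfl fun i _ => ?_
  rw [← Finset.mul_prod_erase _ _ (Finset.mem_univ i), if_pos rfl, one_mul]
  exact Finset.prod_congr rfl fun j hj => if_neg (Finset.ne_of_mem_erase hj)

theorem omitSum_append {R : Type*} [CommRing R] {a b : ℕ} (f : Fin a → R) (g : Fin b → R) :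
    omitSum (Fin.append f g) = omitSum f * ∏ j, g j + (∏ j, f j) * omitSum g := by
  have h1 : ∀ (i : Fin a) (j : Fin b), Fin.natAdd a j ≠ Fin.castAdd b i := fun i j h => by
    have := congrArg Fin.val h
    simp only [Fin.val_natAdd, Fin.val_castAdd] at this
    omega
  simp only [omitSum, Fin.sum_univ_add, Fin.prod_univ_add, Fin.append_left, Fin.append_right,
    Fin.castAdd_inj, Fin.natAdd_inj, if_neg (h1 _ _), if_neg (h1 _ _).symm, Finset.sum_mul,
    Finset.mul_sum]

theorem omitSum_succ {R : Type*} [CommRing R] {m : ℕ} (f : Fin (m + 1) → R) :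
    omitSum f = (∏ j : Fin m, f j.succ) + f 0 * omitSum fun j : Fin m => f j.succ := by
  simp only [omitSum, Fin.sum_univ_succ, Fin.prod_univ_succ, if_true, one_mul, Fin.succ_ne_zero,
    if_false, Fin.succ_inj, (Fin.succ_ne_zero _).symm, Finset.mul_sum]

theorem omitSum_const {R : Type*} [CommRing R] {m : ℕ} (u : R) :
    u * omitSum (fun _ : Fin m => u) = m * u ^ m := by
  rw [omitSum, Finset.mul_sum]
  rw [Finset.sum_congr rfl (g := fun _ => u ^ m)]
  · simp
  · intro i _
    rw [← Finset.mul_prod_erase _ _ (Finset.mem_univ i), if_pos rfl, one_mul,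
      Finset.prod_congr rfl fun j hj => if_neg (Finset.ne_of_mem_erase hj),
      Finset.mul_prod_erase _ (fun _ => u) (Finset.mem_univ i)]
    simp

theorem starPolynomial_ofFn {k : ℕ} (p : Fin k → ℕ) :
    starPolynomial (List.ofFn p) =
      omitSum (fun i => qInt (p i)) + (X + 1 - (k : ℤ[X])) * ∏ i, qInt (p i) := by
  induction k with
  | zero => simp [starPolynomial, omitSum]
  | succ k ih =>
    rw [List.ofFn_succ, starPolynomial, ih, omitSum_succ, Fin.prod_univ_succ, List.map_ofFn,
      List.prod_ofFn]
    push_cast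
    simp only [Function.comp_apply]
    ring

theorem sum_odd_indicator {m : ℕ} (a : ℕ) (hm : m = 2 * a) :
    ∑ i : Fin m, (if Even i.val then 0 else 1 : ℤ[T;T⁻¹]) = a := by
  subst hm
  rw [Fin.sum_univ_eq_sum_range (fun i => if Even i then 0 else (1 : ℤ[T;T⁻¹]))]
  induction a with
  | zero => simp
  | succ a ih =>
    rw [show 2 * (a + 1) = 2 * a + 1 + 1 by ring, Finset.sum_range_succ, Finset.sum_range_succ, ih]
    simp

/-- Half of the `2a` columns have odd index, and each of these contributes an extra `-(1 + T) ∏ g`.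
-/
theorem sum_columnFactor {n : ℕ} (g : Fin (n + 1) → ℤ[T;T⁻¹]) (a : ℕ) (hm : n + 1 = 2 * a) :
    ∑ i, columnFactor g i * ∏ j ∈ Finset.univ.erase i, g j =
      omitSum g - (a : ℤ[T;T⁻¹]) * (1 + T 1) * ∏ i, g i := by
  rw [omitSum_eq_sum_erase, ← sum_odd_indicator a hm, Finset.sum_mul, Finset.sum_mul,
    ← Finset.sum_sub_distrib]
  refine Finset.sum_congr rfl fun i _ => ?_
  rw [← Finset.mul_prod_erase _ g (Finset.mem_univ i), columnFactor]
  split_ifs <;> ring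

/-- The Alexander polynomial of a pretzel link with an even number of columns. -/
theorem dvd_alexander_pretzel_iff {m : ℕ} (q : Fin m → ℤ) (hq : ∀ i, q i ≠ 0) (hm : Even m)
    (a : ℕ) (ha : m = 2 * a) (h0 : ∃ h : 0 < m, 0 < q ⟨0, h⟩)
    (hg : ∀ i, twist (q i) (q i).natAbs ≠ 0) (Q : ℤ[T;T⁻¹]) :
    (∀ i j, Q ∣ (pretzelDiagram q hq hm).alexanderMatrix.adjugate i j) ↔
      Q ∣ omitSum (fun i => twist (q i) (q i).natAbs) -
        (a : ℤ[T;T⁻¹]) * (1 + T 1) * ∏ i, twist (q i) (q i).natAbs := by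
  obtain ⟨hpos, h0⟩ := h0
  obtain ⟨n, rfl⟩ : ∃ n, m = n + 1 := ⟨m - 1, by omega⟩
  rw [dvd_adjugate_alexanderMatrix_pretzel q hq hm h0, ← sum_columnFactor _ a ha]
  exact (det_exitRelations hm _ hg).dvd_iff_dvd_right

theorem twist_natCast {p : ℕ} (hp : 0 < p) :
    twist (p : ℤ) (p : ℤ).natAbs = toLaurent ((qInt p).comp (-X)) := by
  have : (0 : ℤ) < p := by exact_mod_cast hp
  rw [twist, if_pos this]
  simp [qInt, sum_comp]

theorem twist_neg_one : twist (-1) (-1 : ℤ).natAbs = T (-1) := by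
  simp [twist]

theorem qInt_ne_zero {p : ℕ} (hp : 0 < p) : qInt p ≠ 0 := by
  intro h
  have := congrArg (eval 1) h
  simp [qInt, eval_finsetSum] at this
  omega

/-- A column `-1` has twist `T⁻¹`. Up to the unit `T ^ (-(k - 2))`, these columns add `(k - 2) T` to
the coefficient `-(k - 1)(1 + T)` of `∏ [p i]`. The result `1 - k - T` is `X + 1 - k` at `X = -T`.
-/
theorem isAlexanderPolynomial_pretzelLink {k : ℕ} (hk : 2 ≤ k) (p : Fin k → ℕ)
    (hp : ∀ i, 0 < p i) :
    (pretzelLink hk p hp).IsAlexanderPolynomial ((starPolynomial (List.ofFn p)).comp (-X)) := by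
  intro Q
  set q : Fin (k + (k - 2)) → ℤ := Fin.append (fun i => (p i : ℤ)) fun _ : Fin (k - 2) => -1
  have hgq : (fun i => twist (q i) (q i).natAbs) =
      Fin.append (fun i => toLaurent ((qInt (p i)).comp (-X))) fun _ : Fin (k - 2) => T (-1) := by
    funext i
    refine Fin.addCases (fun i => ?_) (fun i => ?_) i
    · simp only [q, Fin.append_left]; exact twist_natCast (hp i)
    · simp only [q, Fin.append_right]; exact twist_neg_one
  have h1 := dvd_alexander_pretzel_iff q
    (fun i => Fin.addCases (fun i => by simpa [q] using (hp i).ne') (fun i => by simp [q]) i)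
    (by rw [Nat.even_iff]; omega) (k - 1) (by omega) ⟨by omega, by
      have : (⟨0, by omega⟩ : Fin (k + (k - 2))) = Fin.castAdd (k - 2) ⟨0, by omega⟩ := rfl
      rw [this]
      simp only [q, Fin.append_left]
      exact_mod_cast hp _⟩
    (fun i => by
      rw [congrFun hgq i]
      refine Fin.addCases (fun i => ?_) (fun i => ?_) i
      · simp only [Fin.append_left]
        exact toLaurent_ne_zero.2 (comp_neg_X_eq_zero_iff.not.2 (qInt_ne_zero (hp i)))
      · simp only [Fin.append_right]
        exact (isUnit_T (-1)).ne_zero) Q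
  refine Iff.trans ?_ h1.symm
  refine Associated.dvd_iff_dvd_right ?_
  refine ⟨(isUnit_T (-1)).unit ^ (k - 2), ?_⟩
  have hprod : ∏ i, twist (q i) (q i).natAbs =
      (∏ i, toLaurent ((qInt (p i)).comp (-X))) * T (-1) ^ (k - 2) := by
    rw [Finset.prod_congr rfl fun i _ => congrFun hgq i, Fin.prod_univ_add]
    simp only [Fin.append_left, Fin.append_right, Finset.prod_const, Finset.card_univ,
      Fintype.card_fin]
  have hS : toLaurent ((omitSum fun i => qInt (p i)).comp (-X)) =
      omitSum fun i => toLaurent ((qInt (p i)).comp (-X)) := by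
    simp only [omitSum, sum_comp, Polynomial.prod_comp, map_sum, map_prod]
    refine Finset.sum_congr rfl fun i _ => Finset.prod_congr rfl fun j _ => ?_
    split_ifs <;> simp
  have hO : omitSum (fun _ : Fin (k - 2) => (T (-1) : ℤ[T;T⁻¹])) =
      T 1 * (((k - 2 : ℕ) : ℤ[T;T⁻¹]) * T (-1) ^ (k - 2)) := by
    rw [← omitSum_const, ← mul_assoc, T_one_mul_T_neg_one, one_mul]
  have hcomp : toLaurent ((starPolynomial (List.ofFn p)).comp (-X)) =
      (omitSum fun i => toLaurent ((qInt (p i)).comp (-X))) +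
        (-T 1 + 1 - (k : ℤ[T;T⁻¹])) * ∏ i, toLaurent ((qInt (p i)).comp (-X)) := by
    rw [starPolynomial_ofFn, add_comp, map_add, hS, mul_comp, map_mul, Polynomial.prod_comp,
      map_prod]
    simp
  rw [hcomp, hprod, hgq, omitSum_append, hO]
  simp only [Finset.prod_const, Finset.card_univ, Fintype.card_fin, Units.val_pow_eq_pow_val,
    IsUnit.unit_spec]
  rw [Nat.cast_sub hk, Nat.cast_sub (by omega : 1 ≤ k)]
  push_cast
  ring

/-- The chosen representative and the star polynomial divide each other as Laurent polynomials, so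
the choice does not affect the measure. -/
theorem alexanderMahlerMeasure_pretzelLink {k : ℕ} (hk : 2 ≤ k) (p : Fin k → ℕ)
    (hp : ∀ i, 0 < p i) (h0 : starPolynomial (List.ofFn p) ≠ 0) :
    (pretzelLink hk p hp).alexanderMahlerMeasure =
      ((starPolynomial (List.ofFn p)).map (Int.castRingHom ℂ)).mahlerMeasure := by
  have h1 := isAlexanderPolynomial_pretzelLink hk p hp
  have h2 := (pretzelLink hk p hp).exists_isAlexanderPolynomial.choose_spec
  have h3 : ∀ Q, Q ∣ toLaurent (pretzelLink hk p hp).alexanderPolynomial ↔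
      Q ∣ toLaurent ((starPolynomial (List.ofFn p)).comp (-X)) :=
    fun Q => (h2 Q).trans (h1 Q).symm
  have h4 := comp_neg_X_eq_zero_iff.not.2 h0
  have h5 : (pretzelLink hk p hp).alexanderPolynomial ≠ 0 := by
    intro h
    have := (h3 0).1 (by rw [h, map_zero])
    rw [zero_dvd_iff, toLaurent_eq_zero] at this
    exact h4 this
  rw [← mahlerMeasure_comp_neg_X]
  have h6 : ((starPolynomial (List.ofFn p)).map (Int.castRingHom ℂ)).comp (-X) =
      ((starPolynomial (List.ofFn p)).comp (-X)).map (Int.castRingHom ℂ) := by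
    simp [Polynomial.map_comp]
  rw [h6]
  exact le_antisymm (mahlerMeasure_le_of_toLaurent_dvd h4 ((h3 _).1 dvd_rfl))
    (mahlerMeasure_le_of_toLaurent_dvd h5 ((h3 _).2 dvd_rfl))

end Star

/-! ### Mahler measures of integer polynomials -/

section IntMahler

/-- The Mahler measure of an integer polynomial. -/
noncomputable def intMahlerMeasure (P : ℤ[X]) : ℝ :=
  (P.map (Int.castRingHom ℂ)).mahlerMeasure

theorem intMahlerMeasure_mul (P Q : ℤ[X]) :
    intMahlerMeasure (P * Q) = intMahlerMeasure P * intMahlerMeasure Q := by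
  simp [intMahlerMeasure, mahlerMeasure_mul]

theorem intMahlerMeasure_X_pow_sub_one {a : ℕ} (ha : 0 < a) :
    intMahlerMeasure (X ^ a - 1) = 1 := by
  rw [intMahlerMeasure, mahlerMeasure_eq_leadingCoeff_mul_prod_roots]
  have h1 : ((X ^ a - 1 : ℤ[X]).map (Int.castRingHom ℂ)) = X ^ a - Polynomial.C 1 := by simp
  rw [h1, (monic_X_pow_sub_C 1 ha.ne').leadingCoeff, norm_one, one_mul]
  refine Multiset.prod_eq_one fun x hx => ?_
  obtain ⟨z, hz, rfl⟩ := Multiset.mem_map.1 hx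
  have h2 : z ^ a = 1 := by
    have := (mem_roots'.1 hz).2
    simpa [sub_eq_zero] using this
  have h3 : ‖z‖ = 1 := by
    rw [← pow_left_inj₀ (norm_nonneg z) zero_le_one ha.ne', ← norm_pow, h2, norm_one, one_pow]
  rw [h3, max_self]

theorem intMahlerMeasure_eq_one_of_mul_eq {P Q R : ℤ[X]} (h : P * Q = R)
    (hR : intMahlerMeasure R = 1) : intMahlerMeasure P = 1 := by
  have hR0 : R ≠ 0 := by
    rintro rfl
    simp [intMahlerMeasure] at hR
  have hP : P ≠ 0 := by rintro rfl; exact hR0 (by rw [← h, zero_mul])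
  have hQ : Q ≠ 0 := by rintro rfl; exact hR0 (by rw [← h, mul_zero])
  have h1 : 1 ≤ intMahlerMeasure P := one_le_mahlerMeasure_of_ne_zero hP
  have h2 : 1 ≤ intMahlerMeasure Q := one_le_mahlerMeasure_of_ne_zero hQ
  rw [← h, intMahlerMeasure_mul] at hR
  nlinarith

theorem le_intMahlerMeasure_of_root {P : ℤ[X]} (hP : P ≠ 0) {μ : ℝ}
    (h : aeval μ P = 0) : μ ≤ intMahlerMeasure P := by
  have h1 : (P.map (Int.castRingHom ℂ)).IsRoot (μ : ℂ) := by
    have h2 : aeval (μ : ℂ) P = 0 := by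
      have := aeval_algebraMap_apply ℂ μ P
      rw [h, map_zero] at this
      exact this
    rwa [IsRoot, eval_map, ← algebraMap_int_eq, ← aeval_def]
  obtain ⟨R, hR⟩ := dvd_iff_isRoot.2 h1
  have hlc : 1 ≤ ‖R.leadingCoeff‖ := by
    have h3 : (P.map (Int.castRingHom ℂ)).leadingCoeff = R.leadingCoeff := by
      rw [hR, leadingCoeff_mul, leadingCoeff_X_sub_C, one_mul]
    rw [← h3, leadingCoeff_map_of_injective (Int.castRingHom ℂ).injective_int, eq_intCast]
    norm_cast
    exact Int.one_le_abs (leadingCoeff_ne_zero.mpr hP)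
  have h4 := hlc.trans R.leadingCoeff_le_mahlerMeasure
  rw [intMahlerMeasure, hR, mahlerMeasure_mul, mahlerMeasure_X_sub_C, Complex.norm_real]
  calc μ ≤ max 1 ‖μ‖ := (le_abs_self μ).trans (le_max_right _ _)
    _ ≤ _ := le_mul_of_one_le_right (by positivity) h4

end IntMahler

/-! ### Star polynomials: real zeros, spherical and affine types -/

section Star

theorem X_sub_one_mul_qInt (p : ℕ) : (X - 1) * qInt p = X ^ p - 1 := by
  rw [qInt, mul_comm, geom_sum_mul]

theorem starPolynomial_perm {l l' : List ℕ} (h : l.Perm l') :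
    starPolynomial l = starPolynomial l' := by
  induction h with
  | nil => rfl
  | cons p h ih => rw [starPolynomial, starPolynomial, ih, (h.map qInt).prod_eq]
  | swap p q l =>
    simp only [starPolynomial, List.map_cons, List.prod_cons]
    ring
  | trans _ _ h1 h2 => exact h1.trans h2

/-- An arm of length `1` consists of the centre alone, and `[1] = 1`. -/
theorem starPolynomial_filter (l : List ℕ) (hl : ∀ p ∈ l, 0 < p) :
    starPolynomial l = starPolynomial (l.filter (2 ≤ ·)) := by
  have h : ∀ l : List ℕ, (∀ p ∈ l, 0 < p) → starPolynomial l = starPolynomial (l.filter (2 ≤ ·)) ∧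
      (l.map qInt).prod = ((l.filter (2 ≤ ·)).map qInt).prod := by
    intro l
    induction l with
    | nil => simp
    | cons p l ih =>
      intro hl
      obtain ⟨h1, h2⟩ := ih fun x hx => hl x (List.mem_cons_of_mem _ hx)
      by_cases hp : 2 ≤ p
      · rw [List.filter_cons_of_pos (by simpa using hp)]
        simp only [starPolynomial, List.map_cons, List.prod_cons, h1, h2, and_self]
      · have : p = 1 := by have := hl p (by simp); omega
        subst this
        rw [List.filter_cons_of_neg (by simp)]
        have h3 : qInt 1 = 1 := by simp [qInt]
        simp only [starPolynomial, List.map_cons, List.prod_cons, h3]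
        exact ⟨by rw [← h1]; ring, by rw [← h2, one_mul]⟩
  exact (h l hl).1

/-- The value of `[p]` at a real number. -/
noncomputable def qReal (x : ℝ) (p : ℕ) : ℝ := ∑ i ∈ Finset.range p, x ^ i

theorem aeval_qInt (x : ℝ) (p : ℕ) : aeval x (qInt p) = qReal x p := by
  simp [qInt, qReal]

theorem one_le_qReal {x : ℝ} (hx : 0 ≤ x) {p : ℕ} (hp : 0 < p) : 1 ≤ qReal x p := by
  obtain ⟨p, rfl⟩ := Nat.exists_eq_add_of_lt hp
  rw [zero_add, qReal, Finset.sum_range_succ', pow_zero]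
  have : 0 ≤ ∑ i ∈ Finset.range p, x ^ (i + 1) := Finset.sum_nonneg fun i _ => by positivity
  linarith

theorem qReal_mono {x : ℝ} (hx : 0 ≤ x) {p p' : ℕ} (h : p ≤ p') : qReal x p ≤ qReal x p' :=
  Finset.sum_le_sum_of_subset_of_nonneg (by simpa using h) fun i _ _ => by positivity

/-- The contribution of an arm to the equation satisfied by the zeros of a star polynomial. -/
noncomputable def armWeight (x : ℝ) (p : ℕ) : ℝ := 1 - (qReal x p)⁻¹

theorem armWeight_mono {x : ℝ} (hx : 0 ≤ x) {p p' : ℕ} (hp : 0 < p) (h : p ≤ p') :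
    armWeight x p ≤ armWeight x p' := by
  have h1 := one_le_qReal hx hp
  have h2 := qReal_mono hx h
  unfold armWeight
  gcongr

theorem armWeight_nonneg {x : ℝ} (hx : 0 ≤ x) {p : ℕ} (hp : 0 < p) : 0 ≤ armWeight x p := by
  unfold armWeight
  have := inv_le_one_of_one_le₀ (one_le_qReal hx hp)
  linarith

theorem armWeight_le_one {x : ℝ} (hx : 0 ≤ x) {p : ℕ} (hp : 0 < p) : armWeight x p ≤ 1 := by
  unfold armWeight
  have := one_le_qReal hx hp
  have : 0 ≤ (qReal x p)⁻¹ := by positivity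
  linarith

theorem aeval_starPolynomial {x : ℝ} (hx : 0 ≤ x) (l : List ℕ) (hl : ∀ p ∈ l, 0 < p) :
    0 < (l.map (qReal x)).prod ∧ aeval x (l.map qInt).prod = (l.map (qReal x)).prod ∧
    aeval x (starPolynomial l) =
      (l.map (qReal x)).prod * (x + 1 - (l.map (armWeight x)).sum) := by
  induction l with
  | nil => simp [starPolynomial]
  | cons p l ih =>
    obtain ⟨h1, h2, h3⟩ := ih fun y hy => hl y (List.mem_cons_of_mem _ hy)
    have hp := one_le_qReal hx (hl p (by simp))
    have hp0 : qReal x p ≠ 0 := by positivity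
    simp only [starPolynomial, List.map_cons, List.prod_cons, List.sum_cons, map_mul, map_add,
      map_sub, map_one, aeval_qInt, h2, h3]
    refine ⟨by positivity, trivial, ?_⟩
    unfold armWeight
    field_simp
    ring

theorem sum_armWeight_le_length {x : ℝ} (hx : 0 ≤ x) (l : List ℕ) (hl : ∀ p ∈ l, 0 < p) :
    (l.map (armWeight x)).sum ≤ l.length := by
  induction l with
  | nil => simp
  | cons p l ih =>
    have h1 := ih fun y hy => hl y (List.mem_cons_of_mem _ hy)
    have h2 := armWeight_le_one hx (hl p (by simp))
    simp only [List.map_cons, List.sum_cons, List.length_cons]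
    push_cast
    linarith

theorem sum_armWeight_nonneg {x : ℝ} (hx : 0 ≤ x) (l : List ℕ) (hl : ∀ p ∈ l, 0 < p) :
    0 ≤ (l.map (armWeight x)).sum :=
  List.sum_nonneg fun y hy => by
    obtain ⟨p, hp, rfl⟩ := List.mem_map.1 hy
    exact armWeight_nonneg hx (hl p hp)

theorem aeval_starPolynomial_pos {x : ℝ} (l : List ℕ) (hl : ∀ p ∈ l, 0 < p)
    (hx : (l.length : ℝ) ≤ x) : 0 < aeval x (starPolynomial l) := by
  have h0 : 0 ≤ x := le_trans (Nat.cast_nonneg _) hx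
  obtain ⟨h1, -, h2⟩ := aeval_starPolynomial h0 l hl
  rw [h2]
  have := sum_armWeight_le_length h0 l hl
  exact mul_pos h1 (by linarith)

theorem starPolynomial_ne_zero (l : List ℕ) (hl : ∀ p ∈ l, 0 < p) : starPolynomial l ≠ 0 := by
  intro h
  have := aeval_starPolynomial_pos l hl le_rfl
  rw [h, map_zero] at this
  exact this.false

/-- If a star polynomial is nonpositive at `x`, then `x` is a lower bound for its Mahler measure. -/
theorem le_intMahlerMeasure_starPolynomial {x : ℝ} (hx : 0 ≤ x) (l : List ℕ) (hl : ∀ p ∈ l, 0 < p)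
    (h : x + 1 ≤ (l.map (armWeight x)).sum) : x ≤ intMahlerMeasure (starPolynomial l) := by
  obtain ⟨h1, -, h2⟩ := aeval_starPolynomial hx l hl
  have h3 : aeval x (starPolynomial l) ≤ 0 := by
    rw [h2]
    exact mul_nonpos_of_nonneg_of_nonpos h1.le (by linarith)
  have h4 := aeval_starPolynomial_pos l hl (le_max_right x (l.length : ℝ))
  obtain ⟨μ, hμ, h5⟩ := intermediate_value_Icc (le_max_left x (l.length : ℝ))
    (starPolynomial l).continuous_aeval.continuousOn ⟨h3, h4.le⟩
  exact hμ.1.trans (le_intMahlerMeasure_of_root (starPolynomial_ne_zero l hl) h5)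

/-- Type `A_{a+b-1}`, with Coxeter polynomial `(X ^ (a + b) - 1) / (X - 1)`. -/
theorem intMahlerMeasure_star_two (a b : ℕ) (ha : 0 < a) :
    intMahlerMeasure (starPolynomial [a, b]) = 1 := by
  refine intMahlerMeasure_eq_one_of_mul_eq (Q := X - 1) (R := X ^ (a + b) - 1) ?_
    (intMahlerMeasure_X_pow_sub_one (by omega))
  simp only [starPolynomial, List.map_cons, List.map_nil, List.prod_cons, List.prod_nil]
  linear_combination (X - 1 : ℤ[X]) * qInt b * X_sub_one_mul_qInt a +
    X_sub_one_mul_qInt a + X ^ a * X_sub_one_mul_qInt b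

/-- Type `D_{c+2}`, with Coxeter polynomial `(X + 1)(X ^ (c + 1) + 1)`. -/
theorem intMahlerMeasure_star_two_two (c : ℕ) :
    intMahlerMeasure (starPolynomial [2, 2, c]) = 1 := by
  refine intMahlerMeasure_eq_one_of_mul_eq (Q := (X - 1) * (X ^ (c + 1) - 1))
    (R := (X ^ 2 - 1) * (X ^ (2 * (c + 1)) - 1)) ?_ ?_
  · simp only [starPolynomial, List.map_cons, List.map_nil, List.prod_cons, List.prod_nil]
    have h2 : qInt 2 = 1 + X := by simp [qInt, Finset.sum_range_succ]
    rw [h2]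
    linear_combination (X - 1 : ℤ[X]) * (X ^ (c + 1) - 1) * (X + 1) * X * X_sub_one_mul_qInt c
  · rw [intMahlerMeasure_mul, intMahlerMeasure_X_pow_sub_one two_pos,
      intMahlerMeasure_X_pow_sub_one (by omega), one_mul]

/-- The shape of the Coxeter polynomials of the affine stars: `(X - 1) ^ 2 [a] [b] [c]`. -/
theorem intMahlerMeasure_affine {l : List ℕ} {a b c : ℕ} (ha : 0 < a) (hb : 0 < b) (hc : 0 < c)
    (h : starPolynomial l * (X - 1) = (X ^ a - 1) * (X ^ b - 1) * (X ^ c - 1)) :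
    intMahlerMeasure (starPolynomial l) = 1 := by
  refine intMahlerMeasure_eq_one_of_mul_eq h ?_
  rw [intMahlerMeasure_mul, intMahlerMeasure_mul, intMahlerMeasure_X_pow_sub_one ha,
    intMahlerMeasure_X_pow_sub_one hb, intMahlerMeasure_X_pow_sub_one hc, one_mul, one_mul]

/-- Types `E₆`, `E₇`, `E₈` and affine `E₈`. The exponents `12`, `18`, `30` are the Coxeter numbers
of the first three, and `Q` is the complementary factor. -/
theorem intMahlerMeasure_star_two_three {c : ℕ} (hc : 3 ≤ c) (hc' : c ≤ 6) :
    intMahlerMeasure (starPolynomial [2, 3, c]) = 1 := by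
  interval_cases c
  · refine intMahlerMeasure_eq_one_of_mul_eq
      (Q := -1 + X - X ^ 2 + X ^ 4 - X ^ 5 + X ^ 6) (R := X ^ 12 - 1) ?_
      (intMahlerMeasure_X_pow_sub_one (by norm_num))
    simp [starPolynomial, qInt, Finset.sum_range_succ]
    ring
  · refine intMahlerMeasure_eq_one_of_mul_eq
      (Q := -1 + X - X ^ 2 + X ^ 9 - X ^ 10 + X ^ 11) (R := X ^ 18 - 1) ?_
      (intMahlerMeasure_X_pow_sub_one (by norm_num))
    simp [starPolynomial, qInt, Finset.sum_range_succ]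
    ring
  · refine intMahlerMeasure_eq_one_of_mul_eq
      (Q := -1 + X - X ^ 2 - X ^ 5 + X ^ 6 - X ^ 7 + X ^ 15 - X ^ 16 + X ^ 17 + X ^ 20 - X ^ 21 +
        X ^ 22) (R := X ^ 30 - 1) ?_ (intMahlerMeasure_X_pow_sub_one (by norm_num))
    simp [starPolynomial, qInt, Finset.sum_range_succ]
    ring
  · refine intMahlerMeasure_affine (a := 2) (b := 3) (c := 5) (by norm_num) (by norm_num)
      (by norm_num) ?_
    simp [starPolynomial, qInt, Finset.sum_range_succ]
    ring

theorem intMahlerMeasure_star_two_four_four :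
    intMahlerMeasure (starPolynomial [2, 4, 4]) = 1 := by
  refine intMahlerMeasure_affine (a := 2) (b := 3) (c := 4) (by norm_num) (by norm_num)
    (by norm_num) ?_
  simp [starPolynomial, qInt, Finset.sum_range_succ]
  ring

theorem intMahlerMeasure_star_three_three_three :
    intMahlerMeasure (starPolynomial [3, 3, 3]) = 1 := by
  refine intMahlerMeasure_affine (a := 2) (b := 3) (c := 3) (by norm_num) (by norm_num)
    (by norm_num) ?_
  simp [starPolynomial, qInt, Finset.sum_range_succ]
  ring

theorem intMahlerMeasure_star_two_two_two_two :
    intMahlerMeasure (starPolynomial [2, 2, 2, 2]) = 1 := by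
  refine intMahlerMeasure_affine (a := 2) (b := 2) (c := 2) (by norm_num) (by norm_num)
    (by norm_num) ?_
  simp [starPolynomial, qInt, Finset.sum_range_succ]
  ring

end Star

/-! ### Lehmer's polynomial -/

section Lehmer

theorem starPolynomial_two_three_seven :
    starPolynomial [2, 3, 7] =
      X ^ 10 + X ^ 9 - X ^ 7 - X ^ 6 - X ^ 5 - X ^ 4 - X ^ 3 + X + 1 := by
  simp [starPolynomial, qInt, Finset.sum_range_succ]
  ring

/-- The trace polynomial of Lehmer's polynomial. -/
noncomputable def lehmerTrace : ℝ[X] :=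
  X ^ 5 + X ^ 4 - 5 * X ^ 3 - 5 * X ^ 2 + 4 * X + 3

theorem eval_lehmerTrace (y : ℝ) :
    lehmerTrace.eval y = y ^ 5 + y ^ 4 - 5 * y ^ 3 - 5 * y ^ 2 + 4 * y + 3 := by
  simp [lehmerTrace]

theorem lehmerTrace_monic : lehmerTrace.Monic := by
  unfold lehmerTrace; monicity!

theorem natDegree_lehmerTrace : lehmerTrace.natDegree = 5 := by
  unfold lehmerTrace; compute_degree!

theorem exists_lehmerTrace_root {a b : ℝ} (hab : a ≤ b)
    (h : lehmerTrace.eval a * lehmerTrace.eval b < 0) :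
    ∃ y, a < y ∧ y < b ∧ lehmerTrace.eval y = 0 := by
  have hc : ContinuousOn (fun y => lehmerTrace.eval y) (Set.Icc a b) :=
    lehmerTrace.continuous.continuousOn
  rcases mul_neg_iff.1 h with ⟨h1, h2⟩ | ⟨h1, h2⟩
  · obtain ⟨y, hy, h3⟩ := intermediate_value_Ioo' hab hc ⟨h2, h1⟩
    exact ⟨y, hy.1, hy.2, h3⟩
  · obtain ⟨y, hy, h3⟩ := intermediate_value_Ioo hab hc ⟨h1, h2⟩
    exact ⟨y, hy.1, hy.2, h3⟩

/-- The Mahler measure of a quadratic factor with two conjugate zeros on the unit circle. -/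
theorem mahlerMeasure_quadratic {τ : ℝ} (h1 : -2 < τ) (h2 : τ < 2) :
    (X ^ 2 - Polynomial.C (τ : ℂ) * X + 1 : ℂ[X]).mahlerMeasure = 1 := by
  have h3 : 0 ≤ 1 - τ ^ 2 / 4 := by nlinarith
  set s := Real.sqrt (1 - τ ^ 2 / 4) with hs
  have hs2 : s ^ 2 = 1 - τ ^ 2 / 4 := Real.sq_sqrt h3
  have hn : ∀ ε : ℝ, ε ^ 2 = 1 → ‖(⟨τ / 2, ε * s⟩ : ℂ)‖ = 1 := by
    intro ε hε
    rw [← pow_left_inj₀ (norm_nonneg _) zero_le_one two_ne_zero, Complex.sq_norm,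
      Complex.normSq_mk]
    linear_combination hε * s ^ 2 + hs2
  have hsum : (τ : ℂ) = (⟨τ / 2, 1 * s⟩ : ℂ) + (⟨τ / 2, -1 * s⟩ : ℂ) := by
    apply Complex.ext <;> simp
  have hprod : (1 : ℂ) = (⟨τ / 2, 1 * s⟩ : ℂ) * (⟨τ / 2, -1 * s⟩ : ℂ) := by
    apply Complex.ext
    · simp; linear_combination -hs2
    · simp; ring
  have hfac : (X ^ 2 - Polynomial.C (τ : ℂ) * X + 1 : ℂ[X]) =
      (X - Polynomial.C (⟨τ / 2, 1 * s⟩ : ℂ)) * (X - Polynomial.C (⟨τ / 2, -1 * s⟩ : ℂ)) := by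
    have h4 := congrArg Polynomial.C hsum
    have h5 := congrArg Polynomial.C hprod
    rw [map_add] at h4
    rw [map_mul, map_one] at h5
    rw [h4]
    linear_combination h5
  rw [hfac, mahlerMeasure_mul, mahlerMeasure_X_sub_C, mahlerMeasure_X_sub_C, hn 1 (by norm_num),
    hn (-1) (by norm_num), max_self, one_mul]

/-- The Mahler measure of the polynomial of `(2, 3, 7)` is its real zero near `1.176`. -/
theorem exists_lehmer_number : ∃ μ : ℝ, 1.176 < μ ∧ μ < 1.177 ∧
    aeval μ (starPolynomial [2, 3, 7]) = 0 ∧ intMahlerMeasure (starPolynomial [2, 3, 7]) = μ := by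
  have hev : ∀ x : ℝ, aeval x (starPolynomial [2, 3, 7]) =
      x ^ 10 + x ^ 9 - x ^ 7 - x ^ 6 - x ^ 5 - x ^ 4 - x ^ 3 + x + 1 := fun x => by
    rw [starPolynomial_two_three_seven]; simp
  obtain ⟨μ, ⟨hμ1, hμ2⟩, hμ⟩ := intermediate_value_Ioo (a := (1.176 : ℝ)) (b := 1.177)
    (f := fun x => aeval x (starPolynomial [2, 3, 7])) (by norm_num)
    (starPolynomial [2, 3, 7]).continuous_aeval.continuousOn
    (show (0 : ℝ) ∈ _ by simp only [hev]; constructor <;> norm_num)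
  refine ⟨μ, hμ1, hμ2, hμ, ?_⟩
  dsimp only at hμ
  rw [hev] at hμ
  have hμ0 : μ ≠ 0 := by positivity
  -- In `y = x + 1/x` the polynomial becomes `lehmerTrace`. Four sign changes in `(-2, 1)` give
  -- pairs of zeros on the unit circle; the fifth root `μ + 1/μ > 2` exhausts the degree, so `μ` is
  -- the only zero outside the circle.
  obtain ⟨τ₁, h11, h12, h1⟩ := exists_lehmerTrace_root (a := -2) (b := -3 / 2) (by norm_num)
    (by norm_num [eval_lehmerTrace])
  obtain ⟨τ₂, h21, h22, h2⟩ := exists_lehmerTrace_root (a := -3 / 2) (b := -1) (by norm_num)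
    (by norm_num [eval_lehmerTrace])
  obtain ⟨τ₃, h31, h32, h3⟩ := exists_lehmerTrace_root (a := -1) (b := 0) (by norm_num)
    (by norm_num [eval_lehmerTrace])
  obtain ⟨τ₄, h41, h42, h4⟩ := exists_lehmerTrace_root (a := 0) (b := 1) (by norm_num)
    (by norm_num [eval_lehmerTrace])
  have h51 : 2 < μ + μ⁻¹ := by
    rw [← sub_pos]
    have : μ + μ⁻¹ - 2 = (μ - 1) ^ 2 / μ := by field_simp; ring
    rw [this]
    have : 0 < μ - 1 := by linarith
    positivity
  have h5 : lehmerTrace.eval (μ + μ⁻¹) = 0 := by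
    rw [eval_lehmerTrace]
    field_simp
    linear_combination hμ
  set τ₅ := μ + μ⁻¹ with hτ₅
  have hsplit : lehmerTrace = (X - Polynomial.C τ₁) * (X - Polynomial.C τ₂) *
      (X - Polynomial.C τ₃) * (X - Polynomial.C τ₄) * (X - Polynomial.C τ₅) := by
    have hnd : ({τ₁, τ₂, τ₃, τ₄, τ₅} : Multiset ℝ).Nodup := by
      simp only [Multiset.insert_eq_cons, Multiset.nodup_cons, Multiset.mem_cons,
        Multiset.mem_singleton, Multiset.nodup_singleton, and_true, not_or]
      refine ⟨⟨?_, ?_, ?_, ?_⟩, ⟨?_, ?_, ?_⟩, ⟨?_, ?_⟩, ?_⟩ <;> intro h <;> linarith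
    have hle : ({τ₁, τ₂, τ₃, τ₄, τ₅} : Multiset ℝ) ≤ lehmerTrace.roots := by
      refine (Multiset.le_iff_subset hnd).2 fun y hy => ?_
      rw [mem_roots lehmerTrace_monic.ne_zero, IsRoot]
      simp only [Multiset.insert_eq_cons, Multiset.mem_cons, Multiset.mem_singleton] at hy
      rcases hy with rfl | rfl | rfl | rfl | rfl <;> assumption
    have hcard : lehmerTrace.roots.card ≤ 5 := natDegree_lehmerTrace ▸ card_roots' _
    have heq := Multiset.eq_of_le_of_card_le hle (by simpa using hcard)
    have hp := prod_multiset_X_sub_C_of_monic_of_roots_card_eq lehmerTrace_monic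
      (by rw [← heq, natDegree_lehmerTrace]; rfl)
    rw [← hp, ← heq]
    simp [mul_assoc]
  have hfac : (starPolynomial [2, 3, 7]).map (Int.castRingHom ℂ) =
      (X ^ 2 - Polynomial.C (τ₁ : ℂ) * X + 1) * (X ^ 2 - Polynomial.C (τ₂ : ℂ) * X + 1) *
      (X ^ 2 - Polynomial.C (τ₃ : ℂ) * X + 1) * (X ^ 2 - Polynomial.C (τ₄ : ℂ) * X + 1) *
      (X ^ 2 - Polynomial.C (τ₅ : ℂ) * X + 1) := by
    have hC : ∀ y : ℂ, y ^ 5 + y ^ 4 - 5 * y ^ 3 - 5 * y ^ 2 + 4 * y + 3 =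
        (y - τ₁) * (y - τ₂) * (y - τ₃) * (y - τ₄) * (y - τ₅) := by
      intro y
      have := congrArg (aeval y) hsplit
      simpa [lehmerTrace, map_ofNat] using this
    refine Polynomial.funext fun x => ?_
    rw [starPolynomial_two_three_seven]
    simp only [Polynomial.map_add, Polynomial.map_sub, Polynomial.map_pow, map_X,
      Polynomial.map_one, eval_add, eval_sub, eval_mul, eval_pow, eval_X, eval_C, eval_one]
    by_cases hx : x = 0
    · simp [hx]
    · have := hC (x + x⁻¹)
      have hq : ∀ τ : ℂ, x ^ 2 - τ * x + 1 = x * (x + x⁻¹ - τ) := fun τ => by field_simp; ring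
      rw [hq, hq, hq, hq, hq]
      calc _ = x ^ 5 * ((x + x⁻¹) ^ 5 + (x + x⁻¹) ^ 4 - 5 * (x + x⁻¹) ^ 3 - 5 * (x + x⁻¹) ^ 2 +
            4 * (x + x⁻¹) + 3) := by field_simp; ring
        _ = _ := by rw [this]; ring
  have hlast : (X ^ 2 - Polynomial.C (τ₅ : ℂ) * X + 1 : ℂ[X]) =
      (X - Polynomial.C (μ : ℂ)) * (X - Polynomial.C ((μ⁻¹ : ℝ) : ℂ)) := by
    have h6 : (Polynomial.C ((μ : ℝ) : ℂ)) * Polynomial.C ((μ⁻¹ : ℝ) : ℂ) = 1 := by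
      rw [← map_mul, ← Complex.ofReal_mul, mul_inv_cancel₀ hμ0, Complex.ofReal_one, map_one]
    rw [hτ₅, Complex.ofReal_add, map_add]
    linear_combination -h6
  rw [intMahlerMeasure, hfac, hlast]
  simp only [mahlerMeasure_mul, mahlerMeasure_X_sub_C]
  rw [mahlerMeasure_quadratic (by linarith) (by linarith),
    mahlerMeasure_quadratic (by linarith) (by linarith),
    mahlerMeasure_quadratic (by linarith) (by linarith),
    mahlerMeasure_quadratic (by linarith) (by linarith), Complex.norm_real, Complex.norm_real,
    Real.norm_of_nonneg (by positivity), Real.norm_of_nonneg (by positivity),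
    max_eq_right (by linarith), max_eq_left (inv_le_one_of_one_le₀ (by linarith))]
  ring

end Lehmer

/-! ### Classification of the arms and conclusion -/

section Main

theorem qReal_bounds {μ : ℝ} (h1 : 1.176 < μ) :
    -- The constants are the values of `[p]` at `1.176`, rounded down.
    2.176 ≤ qReal μ 2 ∧ 3.558 ≤ qReal μ 3 ∧ 5.185 ≤ qReal μ 4 ∧ 7.097 ≤ qReal μ 5 := by
  have h0 : (0 : ℝ) ≤ 1.176 := by norm_num
  have hp : ∀ n : ℕ, (1.176 : ℝ) ^ n ≤ μ ^ n := fun n => pow_le_pow_left₀ h0 h1.le n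
  have p1 := hp 1
  have p2 := hp 2
  have p3 := hp 3
  have p4 := hp 4
  simp only [qReal, Finset.sum_range_succ, Finset.sum_range_zero]
  norm_num at p1 p2 p3 p4 ⊢
  refine ⟨?_, ?_, ?_, ?_⟩ <;> linarith

theorem armWeight_ge {μ c : ℝ} {p : ℕ} (hc : 0 < c) (h : c ≤ qReal μ p) :
    1 - c⁻¹ ≤ armWeight μ p := by
  unfold armWeight
  gcongr

/-- The minimal hyperbolic types other than `(2, 3, 7)`. For these the inequality is strict with
room to spare, so three decimals suffice. -/
theorem sum_armWeight_lower {μ : ℝ} (h1 : 1.176 < μ) (h2 : μ < 1.177) :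
    μ + 1 ≤ armWeight μ 2 + armWeight μ 4 + armWeight μ 5 ∧
    μ + 1 ≤ armWeight μ 3 + armWeight μ 3 + armWeight μ 4 ∧
    μ + 1 ≤ armWeight μ 2 + armWeight μ 2 + armWeight μ 2 + armWeight μ 3 ∧
    μ + 1 ≤ armWeight μ 2 + armWeight μ 2 + armWeight μ 2 + armWeight μ 2 + armWeight μ 2 := by
  obtain ⟨q2, q3, q4, q5⟩ := qReal_bounds h1
  have a2 := armWeight_ge (by norm_num) q2
  have a3 := armWeight_ge (by norm_num) q3
  have a4 := armWeight_ge (by norm_num) q4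
  have a5 := armWeight_ge (by norm_num) q5
  norm_num at a2 a3 a4 a5 h1 h2
  refine ⟨?_, ?_, ?_, ?_⟩ <;> linarith

theorem intMahlerMeasure_star_nil : intMahlerMeasure (starPolynomial []) = 1 := by
  refine intMahlerMeasure_eq_one_of_mul_eq (Q := X - 1) (R := X ^ 2 - 1) ?_
    (intMahlerMeasure_X_pow_sub_one (by norm_num))
  simp only [starPolynomial]
  ring

theorem intMahlerMeasure_star_singleton (a : ℕ) (ha : 0 < a) :
    intMahlerMeasure (starPolynomial [a]) = 1 := by
  rw [← intMahlerMeasure_star_two a 1 ha]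
  congr 1
  simp only [starPolynomial, List.map_cons, List.map_nil, List.prod_cons, List.prod_nil, qInt,
    Finset.sum_range_one, pow_zero]
  ring

theorem star_sorted_dichotomy {μ : ℝ} (h1 : 1.176 < μ) (h2 : μ < 1.177)
    (h : μ + 1 = armWeight μ 2 + armWeight μ 3 + armWeight μ 7) (l : List ℕ)
    (hl : ∀ p ∈ l, 2 ≤ p) (hs : l.Pairwise (· ≤ ·)) :
    intMahlerMeasure (starPolynomial l) = 1 ∨ μ + 1 ≤ (l.map (armWeight μ)).sum := by
  have hμ : (0 : ℝ) ≤ μ := by linarith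
  obtain ⟨w245, w334, w2223, w22222⟩ := sum_armWeight_lower h1 h2
  have mono : ∀ {p p' : ℕ}, 2 ≤ p → p ≤ p' → armWeight μ p ≤ armWeight μ p' :=
    fun hp h => armWeight_mono hμ (by omega) h
  match l, hl, hs with
  | [], _, _ => exact Or.inl intMahlerMeasure_star_nil
  | [a], hl, _ => exact Or.inl (intMahlerMeasure_star_singleton a (by have := hl a (by simp); omega))
  | [a, b], hl, _ =>
    exact Or.inl (intMahlerMeasure_star_two a b (by have := hl a (by simp); omega))
  | [a, b, c], hl, hs =>
    simp only [List.pairwise_cons, List.mem_cons, List.not_mem_nil, or_false, forall_eq_or_imp,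
      forall_eq] at hl hs
    obtain ⟨ha, hb, hc⟩ := hl
    obtain ⟨⟨hab, hac⟩, hbc, -⟩ := hs
    simp only [List.map_cons, List.map_nil, List.sum_cons, List.sum_nil, add_zero]
    by_cases ha3 : 3 ≤ a
    · by_cases hc4 : 4 ≤ c
      · right
        have := mono (by norm_num) ha3
        have := mono (by norm_num) (ha3.trans hab)
        have := mono (by norm_num) hc4
        linarith
      · left
        obtain rfl : a = 3 := by omega
        obtain rfl : b = 3 := by omega
        obtain rfl : c = 3 := by omega
        exact intMahlerMeasure_star_three_three_three
    · obtain rfl : a = 2 := by omega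
      by_cases hb4 : 4 ≤ b
      · by_cases hc5 : 5 ≤ c
        · right
          have := mono (by norm_num) hb4
          have := mono (by norm_num) hc5
          linarith
        · left
          obtain rfl : b = 4 := by omega
          obtain rfl : c = 4 := by omega
          exact intMahlerMeasure_star_two_four_four
      · obtain rfl | rfl : b = 2 ∨ b = 3 := by omega
        · exact Or.inl (intMahlerMeasure_star_two_two c)
        · by_cases hc7 : 7 ≤ c
          · right
            -- Here there is no slack: `(2, 3, 7)` gives equality by the definition of `μ`, so the
            -- exact equation `h` is needed.
            have := mono (by norm_num) hc7
            linarith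
          · exact Or.inl (intMahlerMeasure_star_two_three hbc (by omega))
  | [a, b, c, d], hl, hs =>
    simp only [List.pairwise_cons, List.mem_cons, List.not_mem_nil, or_false, forall_eq_or_imp,
      forall_eq] at hl hs
    obtain ⟨ha, hb, hc, hd⟩ := hl
    obtain ⟨⟨hab, hac, had⟩, ⟨hbc, hbd⟩, hcd, -⟩ := hs
    simp only [List.map_cons, List.map_nil, List.sum_cons, List.sum_nil, add_zero]
    by_cases hd3 : 3 ≤ d
    · right
      have := mono le_rfl ha
      have := mono le_rfl hb
      have := mono le_rfl hc
      have := mono (by norm_num) hd3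
      linarith
    · left
      obtain rfl : a = 2 := by omega
      obtain rfl : b = 2 := by omega
      obtain rfl : c = 2 := by omega
      obtain rfl : d = 2 := by omega
      exact intMahlerMeasure_star_two_two_two_two
  | a :: b :: c :: d :: e :: l, hl, _ =>
    right
    simp only [List.mem_cons, forall_eq_or_imp] at hl
    obtain ⟨ha, hb, hc, hd, he, hl⟩ := hl
    have := sum_armWeight_nonneg hμ l fun p hp => by have := hl p hp; omega
    have := mono le_rfl ha
    have := mono le_rfl hb
    have := mono le_rfl hc
    have := mono le_rfl hd
    have := mono le_rfl he
    simp only [List.map_cons, List.sum_cons]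
    linarith

/-- Among the star polynomials of Mahler measure different from `1`, that of `(2, 3, 7)` has the
smallest one. -/
theorem intMahlerMeasure_starPolynomial_ge (l : List ℕ) (hl : ∀ p ∈ l, 0 < p)
    (h : intMahlerMeasure (starPolynomial l) ≠ 1) :
    intMahlerMeasure (starPolynomial [2, 3, 7]) ≤ intMahlerMeasure (starPolynomial l) := by
  obtain ⟨μ, h1, h2, h3, h4⟩ := exists_lehmer_number
  have hμ : (0 : ℝ) ≤ μ := by linarith
  rw [h4]
  have h5 : μ + 1 = armWeight μ 2 + armWeight μ 3 + armWeight μ 7 := by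
    obtain ⟨h6, -, h7⟩ := aeval_starPolynomial hμ [2, 3, 7] (by simp)
    rw [h3, eq_comm, mul_eq_zero, or_iff_right h6.ne'] at h7
    simp only [List.map_cons, List.map_nil, List.sum_cons, List.sum_nil, add_zero] at h7
    linarith
  have hperm : ((l.filter (2 ≤ ·)).mergeSort).Perm (l.filter (2 ≤ ·)) := List.mergeSort_perm _ _
  have hmem : ∀ p ∈ (l.filter (2 ≤ ·)).mergeSort, 2 ≤ p := fun p hp => by
    have := hperm.mem_iff.1 hp
    simpa using (List.mem_filter.1 this).2
  have hstar : starPolynomial l = starPolynomial ((l.filter (2 ≤ ·)).mergeSort) := by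
    rw [starPolynomial_filter l hl, starPolynomial_perm hperm]
  rw [hstar] at h ⊢
  have hsort : ((l.filter (2 ≤ ·)).mergeSort).Pairwise (· ≤ ·) := List.pairwise_mergeSort' _ _
  exact le_intMahlerMeasure_starPolynomial hμ _ (fun p hp => by have := hmem p hp; omega)
    ((star_sorted_dichotomy h1 h2 h5 _ hmem hsort).resolve_left h)

theorem mainTheorem2 :
    1 < (pretzelLink (k := 3) (by norm_num) ![2, 3, 7] (by decide)).alexanderMahlerMeasure ∧
      ∀ (k : ℕ) (hk : 2 ≤ k) (p : Fin k → ℕ) (hp : ∀ i, 0 < p i),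
        (pretzelLink hk p hp).alexanderMahlerMeasure ≠ 1 →
          (pretzelLink (k := 3) (by norm_num) ![2, 3, 7] (by decide)).alexanderMahlerMeasure ≤
            (pretzelLink hk p hp).alexanderMahlerMeasure := by
  have hM : ∀ (k : ℕ) (hk : 2 ≤ k) (p : Fin k → ℕ) (hp : ∀ i, 0 < p i),
      (pretzelLink hk p hp).alexanderMahlerMeasure =
        intMahlerMeasure (starPolynomial (List.ofFn p)) := fun k hk p hp =>
    alexanderMahlerMeasure_pretzelLink hk p hp (starPolynomial_ne_zero _ (by simpa using hp))
  have h237 : List.ofFn ![2, 3, 7] = [2, 3, 7] := by simp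
  rw [hM, h237]
  refine ⟨?_, fun k hk p hp h => ?_⟩
  · obtain ⟨μ, h1, -, -, h4⟩ := exists_lehmer_number
    rw [h4]
    linarith
  · rw [hM] at h ⊢
    exact intMahlerMeasure_starPolynomial_ge _ (by simpa using hp) h

end Main
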